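/- Let $\mathcal H,\mathcal K$ be finite-dimensional complex Hilbert spaces and let $T:B(\mathcal H)\to B(\mathcal K)$ be a linear, trace-preserving, 2-positive map (applying $T$ entrywise to a positive $2\times 2$ operator matrix gives a positive operator matrix). Let $T^*:B(\mathcal K)\to B(\mathcal H)$ be its adjoint for the inner products $\langle A,B\rangle=\mathrm{Tr}\,A^*B$. Let $D_1,D_2$ be invertible density matrices on $\mathcal H$ such that $T(D_1),T(D_2)$ are invertible. Call $T$ sufficient for $D_1,D_2$ if there is a trace-preserving 2-positive linear map $\beta:B(\mathcal K)\to B(\mathcal H)$ with $\beta(T(D_s))=D_s$ for $s=1,2$. For a $*$-algebra $N$ of operators that is isomorphic to a full matrix algebra $M_k(\mathbb C)$, a density of $N$ means a positive element of $N$ whose trace in $M_k(\mathbb C)$ is $1$ (equivalently, whose ambient trace equals the rank of a minimal projection of $N$). A prime denotes the commutant. (1) If $T$ is sufficient for $D_1,D_2$, then there exist a unital $*$-subalgebra $\mathcal D_{\mathcal K}\subset B(\mathcal K)$, with minimal central projections $z_1,\dots,z_r$ (all of them, listed without repetition), probability distributions $\lambda_1,\lambda_2$ on $\{1,\dots,r\}$,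 densities $S_s(p)$ of $z_p\mathcal D_{\mathcal K}$, densities $R(p)$ of $z_p\mathcal D_{\mathcal K}'$ and densities $R^{\mathcal H}(p)$ of $T^*(z_p)\,T^*(\mathcal D_{\mathcal K})'$ $(s=1,2;\ 1\le p\le r)$, where $R(p)$ and $R^{\mathcal H}(p)$ do not depend on $s$, such that (a) $T^*(XY)=T^*(X)T^*(Y)$ for all $X\in B(\mathcal K)$ and $Y\in\mathcal D_{\mathcal K}$; (b) $T(D_s)=\sum_{p=1}^r\lambda_s(p)\,S_s(p)\,R(p)$ for $s=1,2$; (c) $D_s=\sum_{p=1}^r\lambda_s(p)\,T^*(S_s(p))\,R^{\mathcal H}(p)$ for $s=1,2$. (2) Conversely, if such data satisfying (a), (b) and (c) exist, then $$T^*\big(T(D_2)^{\mathrm i t}\,T(D_1)^{-\mathrm i t}\big)=D_2^{\mathrm i t}D_1^{-\mathrm i t}\qquad\text{for all } t\in\mathbb R,$$ and $T$ is sufficient for $D_1,D_2$. -/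

import Mathlib

open scoped Matrix ComplexOrder

noncomputable section

namespace CoarseGraining

variable {m n : Type*} [Fintype m] [Fintype n] [DecidableEq m] [DecidableEq n]

/-- A linear map `B(H) → B(K)` is 2-positive if applying it entrywise to a positive
`2 × 2` operator matrix gives a positive operator matrix. -/
def IsTwoPositive (T : Matrix m m ℂ →ₗ[ℂ] Matrix n n ℂ) : Prop :=
  ∀ A B C D : Matrix m m ℂ, (Matrix.fromBlocks A B C D).PosSemidef →
    (Matrix.fromBlocks (T A) (T B) (T C) (T D)).PosSemidef

/-- `T` preserves the trace. -/
def IsTracePreserving (T : Matrix m m ℂ →ₗ[ℂ] Matrix n n ℂ) : Prop :=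
  ∀ A : Matrix m m ℂ, (T A).trace = A.trace

/-- A density matrix: positive semidefinite with trace one. -/
def IsDensity (D : Matrix m m ℂ) : Prop :=
  D.PosSemidef ∧ D.trace = 1

/-- `T` is sufficient for the family `D`: some trace-preserving 2-positive map `β` recovers
every `D s` from `T (D s)`. -/
def IsSufficient {ι : Type*} (T : Matrix m m ℂ →ₗ[ℂ] Matrix n n ℂ)
    (D : ι → Matrix m m ℂ) : Prop :=
  ∃ β : Matrix n n ℂ →ₗ[ℂ] Matrix m m ℂ,
    IsTwoPositive β ∧ IsTracePreserving β ∧ ∀ s, β (T (D s)) = D s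

/-- The adjoint `T*` of `T` for the Hilbert-Schmidt inner products `⟨A, B⟩ = Tr (Aᴴ B)`; its
`(i, j)` entry is `⟨E i j, T* X⟩ = ⟨T (E i j), X⟩` with `E i j` the matrix units. -/
def hsAdjoint (T : Matrix m m ℂ →ₗ[ℂ] Matrix n n ℂ) : Matrix n n ℂ →ₗ[ℂ] Matrix m m ℂ where
  toFun X := Matrix.of fun i j => ((T (Matrix.single i j 1))ᴴ * X).trace
  map_add' X Y := by
    ext i j
    simp [Matrix.mul_add]
  map_smul' c X := by
    ext i j
    simp

/-- The defining property of the adjoint. -/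
theorem trace_hsAdjoint (T : Matrix m m ℂ →ₗ[ℂ] Matrix n n ℂ) (A : Matrix m m ℂ)
    (X : Matrix n n ℂ) : (Aᴴ * hsAdjoint T X).trace = ((T A)ᴴ * X).trace := by
  have hA : T A = ∑ i, ∑ j, A i j • T (Matrix.single i j 1) := by
    conv_lhs => rw [Matrix.matrix_eq_sum_single A]
    simp only [map_sum]
    refine Finset.sum_congr rfl fun i _ => Finset.sum_congr rfl fun j _ => ?_
    rw [← map_smul, Matrix.smul_single, smul_eq_mul, mul_one]
  rw [hA]
  simp only [Matrix.conjTranspose_sum, Matrix.conjTranspose_smul, Finset.sum_mul,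
    Matrix.trace_sum, Matrix.smul_mul, Matrix.trace_smul]
  rw [Finset.sum_comm]
  simp [Matrix.trace, Matrix.mul_apply, hsAdjoint]

/-- The power `A ^ (i t) = exp (i t log A)` of a positive definite matrix `A`, for real `t`. -/
def imagPow (A : Matrix m m ℂ) (t : ℝ) : Matrix m m ℂ :=
  NormedSpace.exp (((t : ℂ) * Complex.I) • cfc Real.log A)

/-- `e` is a minimal projection of the set `N` of matrices: a nonzero orthogonal projection
in `N` such that the only projections `f ≤ e` in `N` are `0` and `e`. -/
structure IsMinimalProjection (N : Set (Matrix m m ℂ)) (e : Matrix m m ℂ) : Prop where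
  mem : e ∈ N
  isStarProjection : IsStarProjection e
  ne_zero : e ≠ 0
  minimal : ∀ f ∈ N, IsStarProjection f → e * f = f → f = 0 ∨ f = e

/-- The set `z N = {z Y | Y ∈ N}`. -/
def corner (z : Matrix m m ℂ) (N : Set (Matrix m m ℂ)) : Set (Matrix m m ℂ) :=
  (fun Y => z * Y) '' N

/-- `S` is a density of a *-algebra `N` of matrices that is isomorphic to a full matrix algebra:
a positive element of `N` whose trace is one, for the trace of `N` as a full matrix algebra, that
is, the multiple of the ambient trace which is one at the minimal projections of `N`. -/
structure IsDensityIn (N : Set (Matrix m m ℂ)) (S : Matrix m m ℂ) : Prop where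
  mem : S ∈ N
  posSemidef : S.PosSemidef
  trace_eq : ∀ e, IsMinimalProjection N e → S.trace = e.trace

/-- `z 0, …, z (r - 1)` lists, without repetition, all minimal projections of the
center of the *-algebra `A`. -/
def IsMinimalCentralFamily (A : StarSubalgebra ℂ (Matrix m m ℂ)) {r : ℕ}
    (z : Fin r → Matrix m m ℂ) : Prop :=
  Function.Injective z ∧
    ∀ e, IsMinimalProjection ((A : Set (Matrix m m ℂ)) ∩ Set.centralizer A) e ↔ ∃ p, z p = e

/-- `w` is a probability distribution on `r` points. -/
def IsProbability {r : ℕ} (w : Fin r → ℝ) : Prop :=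
  (∀ p, 0 ≤ w p) ∧ ∑ p, w p = 1

/-- The structure of a coarse-graining `T` relative to a family `D` of densities.  Here `A` is a
*-subalgebra of `B(K)` with minimal central projections `z p`, the `w s` are probability
distributions, `S s p` and `R p` are densities of `z p A` and `z p A'`, and `Q p` is a density of
`T*(z p) T*(A)'`.  Neither `R` nor `Q` depends on the index `s`. -/
structure IsDecomposition {ι : Type*} (T : Matrix m m ℂ →ₗ[ℂ] Matrix n n ℂ)
    (D : ι → Matrix m m ℂ) (A : StarSubalgebra ℂ (Matrix n n ℂ)) {r : ℕ}
    (z : Fin r → Matrix n n ℂ) (w : ι → Fin r → ℝ) (S : ι → Fin r → Matrix n n ℂ)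
    (R : Fin r → Matrix n n ℂ) (Q : Fin r → Matrix m m ℂ) : Prop where
  central : IsMinimalCentralFamily A z
  prob : ∀ s, IsProbability (w s)
  /-- `T*` is multiplicative when one factor lies in the subalgebra. -/
  map_mul : ∀ X, ∀ Y ∈ A, hsAdjoint T (X * Y) = hsAdjoint T X * hsAdjoint T Y
  density_left : ∀ s p, IsDensityIn (corner (z p) A) (S s p)
  density_right : ∀ p, IsDensityIn (corner (z p) (Set.centralizer A)) (R p)
  /-- The decomposition of the densities on `K`. -/
  image_eq : ∀ s, T (D s) = ∑ p, (w s p : ℂ) • (S s p * R p)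
  density_source : ∀ p, IsDensityIn
    (corner (hsAdjoint T (z p)) (Set.centralizer (hsAdjoint T '' A))) (Q p)
  /-- The corresponding decomposition of the densities on `H`. -/
  source_eq : ∀ s, D s = ∑ p, (w s p : ℂ) • (hsAdjoint T (S s p) * Q p)

end CoarseGraining

end

/-!
The adjoint `α = T*` is a unital 2-positive map, and so is the adjoint `γ` of a recovery map.
They intertwine the functionals with densities `D s` and `T (D s)`, which are faithful. At a fixed
point of `γ ∘ α` the Schwarz inequalities for `α` and `γ` are therefore equalities, and equality
makes a 2-positive map multiplicative (`IsTwoPositive.map_mul`, `IsReversiblePair.map_mul`). Hence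
the fixed points of `γ ∘ α` form a *-algebra `A`, which `α` maps isomorphically onto the fixed
point algebra of `α ∘ γ`, with inverse `γ`. The algebra `A` is the one that the theorem asks for.

The range of `1 - γ ∘ α` is orthogonal to `A` for every one of the functionals and complements `A`,
so all functionals are invariant under the same conditional expectation onto `A`
(`IsReversiblePair.admitsExpectation`). This expectation maps the commutant `A'` into the center
of `A`, which is trivial below a minimal central projection `z`. So on `z A A'` every functional is
a product functional, and the factor on `A'` does not depend on `s`. The trace has the same product
property, and `A A'` spans the corner at `z` by a bicommutant argument. Comparing the two products
writes `T (D s) z` as a product of a density of `z A` and a density of `z A'`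
(`AdmitsExpectation.mul_eq`, `AdmitsExpectation.exists_isDensityIn`). The normalizations fit, since
minimal projections of `z A` and `z A'` have a product of trace one
(`IsMinimalCentral.trace_mul_trace`). The same decomposition on the other side involves the
images under `α` of the same densities, because a factor has only one trace up to scalars
(`IsReversiblePair.map_density_eq`).

For the converse, sum the decomposition over the blocks: `T (D s) = σ s * ρ` and
`D s = α (σ s) * q` with `σ s` in `A`, and with commuting positive factors `ρ` and `q` that do not
depend on `s` (`IsFactorization`). The common factors cancel in the cocycles, which reduces the
cocycle identity to the multiplicativity of `α` on `A`. They also cancel in the map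
`Y ↦ D^{1/2} α (T(D)^{-1/2} Y T(D)^{-1/2}) D^{1/2}` for one fixed density `D`, which therefore
recovers all densities.
-/

namespace CoarseGraining

/-! ### Matrix *-algebras, commutants and the bicommutant property -/

section Preliminaries

variable {n : Type*} [Fintype n] [DecidableEq n]

/-- On a finite set, in particular on the spectrum of a matrix, every function is a polynomial. -/
theorem exists_polynomial_eqOn (f : ℝ → ℝ) {s : Set ℝ} (hs : s.Finite) :
    ∃ p : Polynomial ℝ, Set.EqOn f (fun x => p.eval x) s := by
  refine ⟨Lagrange.interpolate hs.toFinset id f, fun x hx => ?_⟩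
  have := Lagrange.eval_interpolate_at_node (s := hs.toFinset) (v := id) f
    (Function.injective_id.injOn) (hs.mem_toFinset.2 hx)
  simpa using this.symm

theorem continuousOn_spectrum (f : ℝ → ℝ) (a : Matrix n n ℂ) :
    ContinuousOn f (spectrum ℝ a) :=
  (Matrix.finite_real_spectrum (A := a)).continuousOn f

/-- The functional calculus of a matrix stays in every *-algebra that contains the matrix, being
given by polynomials. -/
theorem cfc_mem (N : StarSubalgebra ℂ (Matrix n n ℂ)) {a : Matrix n n ℂ} (ha : a ∈ N)
    (f : ℝ → ℝ) : cfc f a ∈ N := by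
  by_cases h : IsSelfAdjoint a
  · obtain ⟨p, hp⟩ := exists_polynomial_eqOn f (Matrix.finite_real_spectrum (A := a))
    rw [cfc_congr hp, cfc_polynomial p a h]
    have h1 : Algebra.adjoin ℝ {a} ≤ N.toSubalgebra.restrictScalars ℝ :=
      Algebra.adjoin_le (by simpa using ha)
    exact h1 (Polynomial.aeval_mem_adjoin_singleton ℝ a)
  · rw [cfc_apply_of_not_predicate a h]
    exact N.zero_mem

/-- The commutant of a *-algebra of matrices. -/
noncomputable def commutant (N : StarSubalgebra ℂ (Matrix n n ℂ)) :
    StarSubalgebra ℂ (Matrix n n ℂ) :=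
  StarSubalgebra.centralizer ℂ (N : Set (Matrix n n ℂ))

theorem mem_commutant {N : StarSubalgebra ℂ (Matrix n n ℂ)} {Y : Matrix n n ℂ} :
    Y ∈ commutant N ↔ ∀ X ∈ N, X * Y = Y * X := by
  rw [commutant, StarSubalgebra.mem_centralizer_iff]
  exact ⟨fun h X hX => (h X hX).1, fun h X hX => ⟨h X hX, h _ (star_mem hX)⟩⟩

theorem coe_commutant (N : StarSubalgebra ℂ (Matrix n n ℂ)) :
    (commutant N : Set (Matrix n n ℂ)) = Set.centralizer N := by
  ext Y
  simp [mem_commutant, Set.mem_centralizer_iff]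

theorem coe_inf_commutant (N : StarSubalgebra ℂ (Matrix n n ℂ)) :
    ((N ⊓ commutant N : StarSubalgebra ℂ (Matrix n n ℂ)) : Set (Matrix n n ℂ)) =
      (N : Set (Matrix n n ℂ)) ∩ Set.centralizer N := by
  rw [StarSubalgebra.coe_inf, coe_commutant]

theorem conjTranspose_mem {N : StarSubalgebra ℂ (Matrix n n ℂ)} {X : Matrix n n ℂ}
    (hX : X ∈ N) : Xᴴ ∈ N := star_mem hX

omit [DecidableEq n] in
/-- Elements of a self-adjoint space of matrices are separated by the traces against it. -/
theorem eq_of_trace_mul_eq {V : Submodule ℂ (Matrix n n ℂ)} (hV : ∀ X ∈ V, Xᴴ ∈ V)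
    {a b : Matrix n n ℂ} (ha : a ∈ V) (hb : b ∈ V)
    (h : ∀ Y ∈ V, (a * Y).trace = (b * Y).trace) : a = b := by
  have h1 := h _ (hV _ (V.sub_mem ha hb))
  rw [← sub_eq_zero, ← Matrix.trace_sub, ← Matrix.sub_mul] at h1
  exact sub_eq_zero.1 (Matrix.trace_mul_conjTranspose_self_eq_zero_iff.1 h1)

/-- The Hilbert-Schmidt orthogonal projection onto a self-adjoint space of matrices. -/
theorem exists_traceProjection (V : Submodule ℂ (Matrix n n ℂ)) (hV : ∀ X ∈ V, Xᴴ ∈ V) :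
    ∃ P : Matrix n n ℂ →ₗ[ℂ] Matrix n n ℂ, (∀ X, P X ∈ V) ∧
      ∀ X, ∀ Y ∈ V, (P X * Y).trace = (X * Y).trace := by
  -- The trace form is nondegenerate on `V`, so every functional on `V` is given by an element
  -- of `V`.
  let B : Matrix n n ℂ →ₗ[ℂ] Module.Dual ℂ V :=
    { toFun := fun X => (Matrix.traceLinearMap n ℂ ℂ) ∘ₗ (LinearMap.mulLeft ℂ X) ∘ₗ V.subtype
      map_add' := fun X Y => by ext; simp [Matrix.add_mul]
      map_smul' := fun c X => by ext; simp }
  have hB : ∀ X (Y : V), B X Y = (X * (Y : Matrix n n ℂ)).trace := fun X Y => rfl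
  have hinj : Function.Injective (B ∘ₗ V.subtype) := by
    intro a b hab
    refine Subtype.ext (eq_of_trace_mul_eq hV a.2 b.2 fun Y hY => ?_)
    exact LinearMap.congr_fun hab ⟨Y, hY⟩
  let e : V ≃ₗ[ℂ] Module.Dual ℂ V := LinearEquiv.ofBijective (B ∘ₗ V.subtype)
    ⟨hinj, (LinearMap.injective_iff_surjective_of_finrank_eq_finrank
      (Subspace.dual_finrank_eq).symm).1 hinj⟩
  refine ⟨V.subtype ∘ₗ e.symm.toLinearMap ∘ₗ B, fun X => (e.symm (B X)).2, fun X Y hY => ?_⟩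
  have h1 : e (e.symm (B X)) = B X := e.apply_symm_apply _
  exact LinearMap.congr_fun h1 ⟨Y, hY⟩

/-- A form of the bicommutant theorem: a self-adjoint space `V ∋ 1` of matrices that is stable
under left multiplication by a self-adjoint set `S` contains the bicommutant of `S`. The blocks
of the Hilbert-Schmidt projection onto `V` commute with `S`, hence an element `T` of the
bicommutant satisfies `P T = T * P 1 = T`. -/
theorem mem_of_mem_bicommutant {V : Submodule ℂ (Matrix n n ℂ)} (hV : ∀ X ∈ V, Xᴴ ∈ V)
    (h1 : (1 : Matrix n n ℂ) ∈ V) {S : Set (Matrix n n ℂ)} (hS : ∀ a ∈ S, aᴴ ∈ S)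
    (hSV : ∀ a ∈ S, ∀ X ∈ V, a * X ∈ V) {T : Matrix n n ℂ}
    (hT : ∀ C : Matrix n n ℂ, (∀ a ∈ S, a * C = C * a) → T * C = C * T) : T ∈ V := by
  obtain ⟨P, hPV, hP⟩ := exists_traceProjection V hV
  have hfix : ∀ X ∈ V, P X = X := fun X hX => eq_of_trace_mul_eq hV (hPV X) hX (hP X)
  have hmod : ∀ a ∈ S, ∀ X, P (a * X) = a * P X := by
    intro a ha X
    refine eq_of_trace_mul_eq hV (hPV _) (hSV a ha _ (hPV X)) fun Y hY => ?_
    have hYa : Y * a ∈ V := by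
      have := hV _ (hSV _ (hS a ha) _ (hV Y hY))
      simpa using this
    rw [hP _ _ hY, Matrix.mul_assoc, Matrix.trace_mul_comm, Matrix.mul_assoc, ← hP _ _ hYa,
      Matrix.mul_assoc a, Matrix.trace_mul_comm a, Matrix.mul_assoc]
  -- `P`, as an operator on `n × n` matrices, has blocks `C j l` that send column `l` to column `j`.
  let C : n → n → Matrix n n ℂ := fun j l => Matrix.of fun i k => P (Matrix.single k l 1) i j
  have key : ∀ (a : Matrix n n ℂ) (j l : n), (∀ k, P (a * Matrix.single k l 1) =
      a * P (Matrix.single k l 1)) ↔ ∀ j, a * C j l = C j l * a := by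
    intro a j l
    have e1 : ∀ j i k, (a * C j l) i k = (a * P (Matrix.single k l 1)) i j := by
      intro j i k
      simp [Matrix.mul_apply, C]
    have e2 : ∀ j i k, (C j l * a) i k = P (a * Matrix.single k l 1) i j := by
      intro j i k
      have : a * Matrix.single k l 1 = ∑ s, a s k • Matrix.single s l (1 : ℂ) := by
        ext x y
        by_cases hy : l = y <;>
          simp [Matrix.mul_apply, Matrix.sum_apply, Matrix.single_apply, hy]
      rw [this, map_sum, Matrix.sum_apply]
      simp only [map_smul, Matrix.smul_apply, smul_eq_mul, Matrix.mul_apply, C, Matrix.of_apply,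
        mul_comm]
    constructor
    · intro h j
      ext i k
      rw [e1, e2, h]
    · intro h k
      ext i j
      rw [← e1, ← e2, h]
  have hTP : ∀ k l, P (T * Matrix.single k l 1) = T * P (Matrix.single k l 1) := by
    intro k l
    refine (key T k l).2 (fun j => hT _ fun a ha => ?_) k
    exact (key a k l).1 (fun k => hmod a ha _) j
  have h2 : P (T * 1) = T * P 1 := by
    have : (1 : Matrix n n ℂ) = ∑ i, Matrix.single i i 1 := by
      ext x y
      by_cases hxy : x = y
      · subst hxy
        simp [Matrix.sum_apply, Matrix.single_apply]
      · have : ∀ i, ¬ (i = x ∧ i = y) := fun i hi => hxy (hi.1.symm.trans hi.2)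
        simp [Matrix.sum_apply, hxy, this]
    rw [this, Finset.mul_sum, map_sum, map_sum, Finset.mul_sum]
    exact Finset.sum_congr rfl fun i _ => hTP i i
  rw [hfix 1 h1, mul_one] at h2
  exact h2 ▸ hPV T

end Preliminaries

/-! ### Minimal projections -/

section MinimalProjections

variable {n : Type*} [Fintype n] [DecidableEq n]

omit [DecidableEq n] in
theorem IsMinimalProjection.mul_self {N : Set (Matrix n n ℂ)} {e : Matrix n n ℂ}
    (he : IsMinimalProjection N e) : e * e = e := he.isStarProjection.isIdempotentElem

omit [DecidableEq n] in
theorem IsMinimalProjection.conjTranspose {N : Set (Matrix n n ℂ)} {e : Matrix n n ℂ}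
    (he : IsMinimalProjection N e) : eᴴ = e := he.isStarProjection.isSelfAdjoint

omit [DecidableEq n] in
theorem trace_pos_of_isStarProjection {e : Matrix n n ℂ} (he : IsStarProjection e)
    (h0 : e ≠ 0) : 0 < e.trace := by
  have h1 : eᴴ * e = e := by
    rw [show eᴴ = e from he.isSelfAdjoint]; exact he.isIdempotentElem
  have h2 := (Matrix.posSemidef_conjTranspose_mul_self e).trace_nonneg
  have h3 : (eᴴ * e).trace ≠ 0 := fun h => h0 (Matrix.trace_conjTranspose_mul_self_eq_zero_iff.1 h)
  rw [h1] at h2 h3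
  exact lt_of_le_of_ne h2 h3.symm

omit [DecidableEq n] in
theorem IsMinimalProjection.trace_pos {N : Set (Matrix n n ℂ)} {e : Matrix n n ℂ}
    (he : IsMinimalProjection N e) : 0 < e.trace :=
  trace_pos_of_isStarProjection he.isStarProjection he.ne_zero

/-- The spectral projection of `h` at a nonzero spectral value `l` lies in `N` and below `e`, so it
is `e` by minimality, and `h = l e`. -/
theorem IsMinimalProjection.exists_smul_of_isSelfAdjoint
    {N : StarSubalgebra ℂ (Matrix n n ℂ)} {e h : Matrix n n ℂ}
    (he : IsMinimalProjection (N : Set (Matrix n n ℂ)) e) (hN : h ∈ N) (hh : IsSelfAdjoint h)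
    (heh : e * h = h) : ∃ κ : ℂ, h = κ • e := by
  by_cases h0 : ∀ x ∈ spectrum ℝ h, x = 0
  · refine ⟨0, ?_⟩
    rw [zero_smul]
    exact ((cfc_id ℝ h hh).symm.trans (cfc_congr (g := fun _ => (0 : ℝ)) h0)).trans
      (cfc_const_zero ℝ h)
  push Not at h0
  obtain ⟨l, hl, hl0⟩ := h0
  let χ : ℝ → ℝ := fun x => if x = l then 1 else 0
  have hc : ∀ f : ℝ → ℝ, ContinuousOn f (spectrum ℝ h) := fun f => continuousOn_spectrum f h
  have hf : IsStarProjection (cfc χ h) := by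
    refine ⟨?_, cfc_predicate χ h⟩
    rw [IsIdempotentElem, ← cfc_mul χ χ h (hc _) (hc _)]
    exact cfc_congr fun x _ => by simp [χ]
  have hf0 : cfc χ h ≠ 0 := by
    intro h1
    rw [← cfc_const_zero ℝ h] at h1
    have := eqOn_of_cfc_eq_cfc h1 (hc _) (hc _) hh hl
    simp [χ] at this
  have hhf : h * cfc χ h = l • cfc χ h := by
    nth_rewrite 1 [← cfc_id' ℝ h hh]
    rw [← cfc_mul _ χ h (hc _) (hc _), ← cfc_smul l χ h (hc _)]
    refine cfc_congr fun x _ => ?_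
    by_cases hx : x = l <;> simp [χ, hx]
  have hef : e * cfc χ h = cfc χ h := by
    have : cfc χ h = l⁻¹ • (h * cfc χ h) := by rw [hhf, smul_smul, inv_mul_cancel₀ hl0, one_smul]
    rw [this, mul_smul_comm, ← Matrix.mul_assoc, heh]
  have hfe : cfc χ h = e := (he.minimal _ (cfc_mem N hN χ) hf hef).resolve_left hf0
  have hhe : h * e = h := by
    have := congrArg Matrix.conjTranspose heh
    rwa [Matrix.conjTranspose_mul, he.conjTranspose, show hᴴ = h from hh] at this
  refine ⟨l, ?_⟩
  rw [hfe, hhe] at hhf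
  rw [hhf]
  ext i j
  simp

/-- If `e` is minimal in `N`, then `e N e` is one-dimensional. -/
theorem IsMinimalProjection.exists_smul {N : StarSubalgebra ℂ (Matrix n n ℂ)}
    {e X : Matrix n n ℂ} (he : IsMinimalProjection (N : Set (Matrix n n ℂ)) e) (hX : X ∈ N) :
    ∃ κ : ℂ, e * X * e = κ • e := by
  have heN : e ∈ N := he.mem
  let Y := e * X * e
  have hY : Y ∈ N := mul_mem (mul_mem heN hX) heN
  have heY : e * Y = Y := by simp only [Y, ← Matrix.mul_assoc, he.mul_self]
  have heY' : e * Yᴴ = Yᴴ := by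
    simp only [Y, Matrix.conjTranspose_mul, he.conjTranspose, ← Matrix.mul_assoc, he.mul_self]
  -- The real and imaginary parts of `e X e` are multiples of `e`.
  obtain ⟨a, ha⟩ := he.exists_smul_of_isSelfAdjoint (h := Y + Yᴴ)
    (add_mem hY (conjTranspose_mem hY)) (IsSelfAdjoint.add_star_self Y)
    (by rw [Matrix.mul_add, heY, heY'])
  obtain ⟨b, hb⟩ := he.exists_smul_of_isSelfAdjoint (h := Complex.I • (Y - Yᴴ))
    (N.smul_mem (sub_mem hY (conjTranspose_mem hY)) _)
    (by
      change (Complex.I • (Y - Yᴴ))ᴴ = _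
      rw [Matrix.conjTranspose_smul, Matrix.conjTranspose_sub, Matrix.conjTranspose_conjTranspose]
      ext i j
      simp
      ring)
    (by rw [mul_smul_comm, Matrix.mul_sub, heY, heY'])
  refine ⟨(a - Complex.I * b) / 2, ?_⟩
  change Y = _
  have h1 : (2 : ℂ) • Y = (Y + Yᴴ) - Complex.I • (Complex.I • (Y - Yᴴ)) := by
    rw [smul_smul, Complex.I_mul_I, neg_one_smul, sub_neg_eq_add, two_smul]
    abel
  rw [ha, hb, smul_smul, ← sub_smul] at h1
  rw [div_eq_inv_mul, mul_smul, ← h1, smul_smul, inv_mul_cancel₀ two_ne_zero, one_smul]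

/-- Below every nonzero projection of a set of matrices there is a minimal one: among the nonzero
projections below it, take one with minimal range. -/
theorem exists_isMinimalProjection_le {N : Set (Matrix n n ℂ)} {q : Matrix n n ℂ}
    (hqN : q ∈ N) (hq : IsStarProjection q) (h0 : q ≠ 0) :
    ∃ e, IsMinimalProjection N e ∧ q * e = e := by
  let P : Submodule ℂ (n → ℂ) → Prop := fun W => ∃ e, e ∈ N ∧ IsStarProjection e ∧ e ≠ 0 ∧
    q * e = e ∧ W = LinearMap.range e.mulVecLin
  obtain ⟨W, ⟨e, heN, he, he0, hqe, rfl⟩, hmin⟩ :=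
    exists_minimal_of_wellFoundedLT P ⟨_, q, hqN, hq, h0, hq.isIdempotentElem, rfl⟩
  refine ⟨e, ⟨heN, he, he0, fun f hfN hf hef => ?_⟩, hqe⟩
  by_cases hf0 : f = 0
  · exact Or.inl hf0
  right
  have h1 : LinearMap.range f.mulVecLin ≤ LinearMap.range e.mulVecLin := by
    rintro _ ⟨v, rfl⟩
    exact ⟨f *ᵥ v, by simp [Matrix.mulVec_mulVec, hef]⟩
  have h2 := hmin ⟨f, hfN, hf, hf0, by rw [← hef, ← Matrix.mul_assoc, hqe], rfl⟩ h1
  -- `f` and `e` have the same range, so `f` fixes the columns of `e`.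
  have h3 : f * e = e := by
    refine Matrix.ext_of_mulVec_single fun i => ?_
    obtain ⟨w, hw⟩ := h2 ⟨Pi.single i 1, rfl⟩
    simp only [Matrix.mulVecLin_apply] at hw
    rw [← Matrix.mulVec_mulVec, ← hw, Matrix.mulVec_mulVec, hf.isIdempotentElem]
  have h4 := congrArg Matrix.conjTranspose h3
  rw [Matrix.conjTranspose_mul, show fᴴ = f from hf.isSelfAdjoint,
    show eᴴ = e from he.isSelfAdjoint, hef] at h4
  exact h4

/-- The minimal projections of the corner at a projection `z` are those of the algebra that lie
below `z`. -/
theorem isMinimalProjection_corner_iff {N : StarSubalgebra ℂ (Matrix n n ℂ)} {z e : Matrix n n ℂ}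
    (hzN : z ∈ N) (hz : z * z = z) :
    IsMinimalProjection (corner z (N : Set (Matrix n n ℂ))) e ↔
      IsMinimalProjection (N : Set (Matrix n n ℂ)) e ∧ z * e = e := by
  constructor
  · intro he
    obtain ⟨Y, hY, hYe⟩ := he.mem
    simp only at hYe
    have hze : z * e = e := by rw [← hYe, ← Matrix.mul_assoc, hz]
    refine ⟨⟨hYe ▸ mul_mem hzN hY, he.isStarProjection, he.ne_zero, fun f hf hfp hef => ?_⟩, hze⟩
    exact he.minimal f ⟨f, hf, by simp only; rw [← hef, ← Matrix.mul_assoc, hze]⟩ hfp hef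
  · rintro ⟨he, hze⟩
    refine ⟨⟨e, he.mem, hze⟩, he.isStarProjection, he.ne_zero, ?_⟩
    rintro _ ⟨Y, hY, rfl⟩ hf hef
    exact he.minimal _ (mul_mem hzN hY) hf hef

end MinimalProjections

/-! ### Factors and their commutants -/

section Factors

variable {n : Type*} [Fintype n] [DecidableEq n]

/-- `z` is a minimal projection of the center of `N`, so that `z N` is a factor. -/
abbrev IsMinimalCentral (N : StarSubalgebra ℂ (Matrix n n ℂ)) (z : Matrix n n ℂ) : Prop :=
  IsMinimalProjection ((N : Set (Matrix n n ℂ)) ∩ Set.centralizer N) z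

namespace IsMinimalCentral

variable {N : StarSubalgebra ℂ (Matrix n n ℂ)} {z : Matrix n n ℂ}

theorem mem_left (hz : IsMinimalCentral N z) : z ∈ N := hz.mem.1

theorem mem_commutant (hz : IsMinimalCentral N z) : z ∈ commutant N :=
  CoarseGraining.mem_commutant.2 fun X hX => hz.mem.2 X hX

theorem comm (hz : IsMinimalCentral N z) {X : Matrix n n ℂ} (hX : X ∈ N) : z * X = X * z :=
  (hz.mem.2 X hX).symm

theorem comm' (hz : IsMinimalCentral N z) {Y : Matrix n n ℂ} (hY : Y ∈ commutant N) :
    z * Y = Y * z :=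
  CoarseGraining.mem_commutant.1 hY z hz.mem_left

/-- The center of the factor `z N` is trivial. -/
theorem exists_mul_eq_smul (hz : IsMinimalCentral N z) {c : Matrix n n ℂ} (hc : c ∈ N)
    (hc' : c ∈ commutant N) : ∃ κ : ℂ, z * c = κ • z := by
  have hz' := hz
  rw [IsMinimalCentral, ← coe_inf_commutant] at hz'
  obtain ⟨κ, hκ⟩ := hz'.exists_smul (X := c) ⟨hc, hc'⟩
  exact ⟨κ, by rw [← hκ, Matrix.mul_assoc, ← hz.comm hc, ← Matrix.mul_assoc, hz.mul_self]⟩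

end IsMinimalCentral

/-- Every matrix acts on a *-algebra `N` through the trace like an element of `N`. -/
theorem exists_mem_trace_eq (N : StarSubalgebra ℂ (Matrix n n ℂ)) (M : Matrix n n ℂ) :
    ∃ a ∈ N, ∀ X ∈ N, (a * X).trace = (M * X).trace := by
  obtain ⟨P, hP, hP'⟩ := exists_traceProjection N.toSubalgebra.toSubmodule
    (fun X hX => conjTranspose_mem (N := N) hX)
  exact ⟨P M, hP M, fun X hX => hP' M X hX⟩

theorem eq_of_mem_of_trace_eq {N : StarSubalgebra ℂ (Matrix n n ℂ)} {a b : Matrix n n ℂ}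
    (ha : a ∈ N) (hb : b ∈ N) (h : ∀ X ∈ N, (a * X).trace = (b * X).trace) : a = b :=
  eq_of_trace_mul_eq (V := N.toSubalgebra.toSubmodule)
    (fun _ hX => conjTranspose_mem (N := N) hX) ha hb h

namespace IsMinimalCentral

variable {N : StarSubalgebra ℂ (Matrix n n ℂ)} {z : Matrix n n ℂ}

/-- A factor carries only one trace up to scalars. -/
theorem exists_trace_eq_smul (hz : IsMinimalCentral N z) {M : Matrix n n ℂ}
    (hM : ∀ X ∈ N, ∀ Y ∈ N, (M * (X * Y)).trace = (M * (Y * X)).trace) :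
    ∃ κ : ℂ, ∀ X ∈ N, (M * (X * z)).trace = κ * (X * z).trace := by
  obtain ⟨c, hc, hcM⟩ := exists_mem_trace_eq N M
  -- The element of `N` that represents a tracial functional is central.
  have hc' : c ∈ commutant N := by
    refine CoarseGraining.mem_commutant.2 fun X hX =>
      eq_of_mem_of_trace_eq (mul_mem hX hc) (mul_mem hc hX) fun Y hY => ?_
    rw [Matrix.mul_assoc, Matrix.trace_mul_comm, Matrix.mul_assoc, Matrix.mul_assoc,
      hcM _ (mul_mem hY hX), hcM _ (mul_mem hX hY), hM X hX Y hY]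
  obtain ⟨κ, hκ⟩ := hz.exists_mul_eq_smul hc hc'
  refine ⟨κ, fun X hX => ?_⟩
  rw [← hcM _ (mul_mem hX hz.mem_left), ← hz.comm hX, ← Matrix.mul_assoc, ← hz.comm hc, hκ,
    Matrix.smul_mul, Matrix.trace_smul, smul_eq_mul]

/-- On `z N N'` the trace is a product functional. -/
theorem trace_mul_mul (hz : IsMinimalCentral N z) {X Y : Matrix n n ℂ} (hX : X ∈ N)
    (hY : Y ∈ commutant N) :
    (X * Y * z).trace * z.trace = (X * z).trace * (Y * z).trace := by
  have hY' := CoarseGraining.mem_commutant.1 hY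
  obtain ⟨κ, hκ⟩ := hz.exists_trace_eq_smul (M := Y) (fun X hX X' hX' => by
    rw [← Matrix.mul_assoc, ← hY' X hX, Matrix.mul_assoc, Matrix.trace_mul_comm,
      Matrix.mul_assoc])
  -- Taking `X = 1` identifies the scalar.
  have h1 := hκ 1 (one_mem N)
  rw [Matrix.one_mul] at h1
  rw [hY' X hX, Matrix.mul_assoc, hκ X hX, h1]
  ring

/-- The corner of the full matrix algebra at `z` is spanned by `N N'`. -/
theorem corner_mem_span (hz : IsMinimalCentral N z) (M : Matrix n n ℂ) :
    z * M * z ∈ Submodule.span ℂ {W | ∃ X ∈ N, ∃ Y ∈ commutant N, W = X * Y} := by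
  set G : Set (Matrix n n ℂ) := {W | ∃ X ∈ N, ∃ Y ∈ commutant N, W = X * Y} with hG
  have hcomm : ∀ X ∈ N, ∀ Y ∈ commutant N, X * Y = Y * X := fun X hX Y hY =>
    CoarseGraining.mem_commutant.1 hY X hX
  refine mem_of_mem_bicommutant (S := (N : Set (Matrix n n ℂ)) ∪ commutant N) ?_ ?_ ?_ ?_ ?_
  · intro X hX
    induction hX using Submodule.span_induction with
    | mem W hW =>
      obtain ⟨X, hX, Y, hY, rfl⟩ := hW
      refine Submodule.subset_span ⟨Xᴴ, conjTranspose_mem hX, Yᴴ, conjTranspose_mem hY, ?_⟩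
      rw [Matrix.conjTranspose_mul, hcomm _ (conjTranspose_mem hX) _ (conjTranspose_mem hY)]
    | zero => simp
    | add a b _ _ ha hb => rw [Matrix.conjTranspose_add]; exact Submodule.add_mem _ ha hb
    | smul c a _ ha => rw [Matrix.conjTranspose_smul]; exact Submodule.smul_mem _ _ ha
  · exact Submodule.subset_span ⟨1, one_mem N, 1, one_mem _, by simp⟩
  · rintro a (ha | ha)
    · exact Or.inl (conjTranspose_mem (N := N) ha)
    · exact Or.inr (conjTranspose_mem (N := commutant N) ha)
  · intro a ha X hX
    induction hX using Submodule.span_induction with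
    | mem W hW =>
      obtain ⟨X, hX, Y, hY, rfl⟩ := hW
      rcases ha with ha | ha
      · exact Submodule.subset_span ⟨a * X, mul_mem ha hX, Y, hY, by rw [Matrix.mul_assoc]⟩
      · exact Submodule.subset_span ⟨X, hX, a * Y, mul_mem ha hY, by
          rw [← Matrix.mul_assoc, ← hcomm X hX a ha, Matrix.mul_assoc]⟩
    | zero => simp
    | add u v _ _ hu hv => rw [Matrix.mul_add]; exact Submodule.add_mem _ hu hv
    | smul c u _ hu => rw [Matrix.mul_smul]; exact Submodule.smul_mem _ _ hu
  · intro C hC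
    have hC1 : C ∈ commutant N := CoarseGraining.mem_commutant.2 fun X hX => hC X (Or.inl hX)
    -- `C` commutes with the commutant, so it lies in `N` by the bicommutant property of `N`.
    have hC2 : C ∈ N := by
      refine mem_of_mem_bicommutant (V := N.toSubalgebra.toSubmodule) (S := N)
        (fun X hX => conjTranspose_mem (N := N) hX) (one_mem N)
        (fun X hX => conjTranspose_mem (N := N) hX) (fun a ha X hX => mul_mem (s := N) ha hX) ?_
      intro B hB
      exact (hC B (Or.inr (CoarseGraining.mem_commutant.2 hB))).symm
    obtain ⟨κ, hκ⟩ := hz.exists_mul_eq_smul hC2 hC1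
    rw [Matrix.mul_assoc, hκ, ← Matrix.mul_assoc, ← Matrix.mul_assoc, ← hz.comm hC2, hκ]
    simp only [Matrix.mul_smul, Matrix.smul_mul, Matrix.mul_assoc]

end IsMinimalCentral

omit [DecidableEq n] in
/-- A projection `g` with one-dimensional corner `g B g` has trace one: in coordinates, the
identity `tr g • g M g = tr (g M) • g` gives `(tr g)² g = g`. -/
theorem trace_eq_one_of_corner {g : Matrix n n ℂ} (hg : IsStarProjection g) (h0 : g ≠ 0)
    (h : ∀ M : Matrix n n ℂ, ∃ κ : ℂ, g * M * g = κ • g) : g.trace = 1 := by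
  classical
  have hpos := trace_pos_of_isStarProjection hg h0
  have hgg : g * g = g := hg.isIdempotentElem
  have h1 : ∀ M : Matrix n n ℂ, g.trace • (g * M * g) = (g * M).trace • g := by
    intro M
    obtain ⟨κ, hκ⟩ := h M
    have h2 := congrArg Matrix.trace hκ
    rw [Matrix.trace_mul_comm, ← Matrix.mul_assoc, hgg, Matrix.trace_smul, smul_eq_mul] at h2
    rw [hκ, h2, smul_smul, mul_comm]
  have h2 : ∀ i j k l, g.trace * (g k i * g j l) = g j i * g k l := by
    intro i j k l
    have h3 := congrFun (congrFun (h1 (Matrix.single i j 1)) k) l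
    have h4 : (g * Matrix.single i j (1 : ℂ)).trace = g j i := by
      rw [Matrix.trace_mul_comm, Matrix.trace_single_mul, one_smul]
    rw [h4] at h3
    simpa [Matrix.mul_single_eq_updateCol_zero, Matrix.mul_apply, Matrix.updateCol_apply,
      Matrix.single_apply, ite_and] using h3
  have h3 : (g.trace * g.trace) • g = g := by
    ext j l
    calc (g.trace * g.trace) * g j l = ∑ i, g.trace * (g i i * g j l) := by
          rw [← Finset.mul_sum, ← Finset.sum_mul, mul_assoc]; rfl
      _ = ∑ i, g j i * g i l := Finset.sum_congr rfl fun i _ => h2 i j i l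
      _ = g j l := by rw [← Matrix.mul_apply, hgg]
  have h4 : g.trace * g.trace = 1 := by
    have h5 := congrArg Matrix.trace h3
    rw [Matrix.trace_smul, smul_eq_mul] at h5
    exact mul_right_cancel₀ hpos.ne' (h5.trans (one_mul _).symm)
  rcases mul_self_eq_one_iff.1 h4 with h5 | h5
  · exact h5
  · rw [h5] at hpos
    norm_num [Complex.lt_def] at hpos

/-- If `z N ≅ M_k ⊗ 1` and `z N' ≅ 1 ⊗ M_l`, minimal projections of `N` and `N'` below `z` have
ambient traces `l` and `k`, and `z` has trace `k l`. -/
theorem IsMinimalCentral.trace_mul_trace {N : StarSubalgebra ℂ (Matrix n n ℂ)}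
    {z e f : Matrix n n ℂ} (hz : IsMinimalCentral N z)
    (he : IsMinimalProjection (N : Set (Matrix n n ℂ)) e) (hze : z * e = e)
    (hf : IsMinimalProjection (commutant N : Set (Matrix n n ℂ)) f) (hzf : z * f = f) :
    e.trace * f.trace = z.trace := by
  have heN : e ∈ N := he.mem
  have hfN : f ∈ commutant N := hf.mem
  have hcomm : ∀ X ∈ N, ∀ Y ∈ commutant N, X * Y = Y * X := fun X hX Y hY =>
    CoarseGraining.mem_commutant.1 hY X hX
  have h1 := hz.trace_mul_mul heN hfN
  have hez : e * z = e := by rw [← hz.comm heN, hze]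
  have hfz : f * z = f := by rw [← hz.comm' hfN, hzf]
  rw [Matrix.mul_assoc, hfz, hez] at h1
  have hg : IsStarProjection (e * f) := by
    constructor
    · rw [IsIdempotentElem, Matrix.mul_assoc, ← Matrix.mul_assoc f, ← hcomm e heN f hfN,
        Matrix.mul_assoc, hf.mul_self, ← Matrix.mul_assoc, he.mul_self]
    · change (e * f)ᴴ = e * f
      rw [Matrix.conjTranspose_mul, he.conjTranspose, hf.conjTranspose, hcomm e heN f hfN]
  have hg0 : e * f ≠ 0 := by
    intro h
    rw [h, Matrix.trace_zero, zero_mul] at h1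
    exact (mul_ne_zero he.trace_pos.ne' hf.trace_pos.ne') h1.symm
  have hgz : e * f * z = e * f := by rw [Matrix.mul_assoc, hfz]
  have hzg : z * (e * f) = e * f := by rw [← Matrix.mul_assoc, hze]
  -- `e f` cuts `N N'` down to scalars, as `e` and `f` do with `N` and `N'`, so it has rank one.
  have hcor : ∀ W ∈ Submodule.span ℂ {W | ∃ X ∈ N, ∃ Y ∈ commutant N, W = X * Y},
      ∃ κ : ℂ, e * f * W * (e * f) = κ • (e * f) := by
    intro W hW
    induction hW using Submodule.span_induction with
    | mem W hW =>
      obtain ⟨X, hX, Y, hY, rfl⟩ := hW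
      obtain ⟨a, ha⟩ := he.exists_smul hX
      obtain ⟨b, hb⟩ := hf.exists_smul hY
      refine ⟨a * b, ?_⟩
      calc e * f * (X * Y) * (e * f) = e * (f * X) * (Y * e) * f := by noncomm_ring
        _ = e * (X * f) * (e * Y) * f := by rw [hcomm X hX f hfN, hcomm e heN Y hY]
        _ = e * X * (f * e) * Y * f := by noncomm_ring
        _ = (e * X * e) * (f * Y * f) := by rw [← hcomm e heN f hfN]; noncomm_ring
        _ = (a * b) • (e * f) := by
          rw [ha, hb, Matrix.smul_mul, Matrix.mul_smul, smul_smul]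
    | zero => exact ⟨0, by simp⟩
    | add u v _ _ hu hv =>
      obtain ⟨a, ha⟩ := hu
      obtain ⟨b, hb⟩ := hv
      exact ⟨a + b, by rw [Matrix.mul_add, Matrix.add_mul, ha, hb, add_smul]⟩
    | smul c u _ hu =>
      obtain ⟨a, ha⟩ := hu
      exact ⟨c * a, by rw [Matrix.mul_smul, Matrix.smul_mul, ha, smul_smul]⟩
  have htr : (e * f).trace = 1 := by
    refine trace_eq_one_of_corner hg hg0 fun M => ?_
    obtain ⟨κ, hκ⟩ := hcor _ (hz.corner_mem_span M)
    refine ⟨κ, ?_⟩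
    rw [← hκ]
    calc e * f * M * (e * f) = (e * f * z) * M * (z * (e * f)) := by rw [hgz, hzg]
      _ = _ := by noncomm_ring
  rw [htr, one_mul] at h1
  exact h1.symm

open scoped MatrixOrder in
/-- The projection of a positive matrix onto a *-algebra along the trace is positive. -/
theorem posSemidef_of_trace_eq {N : StarSubalgebra ℂ (Matrix n n ℂ)} {a M : Matrix n n ℂ}
    (ha : a ∈ N) (hM : M.PosSemidef) (h : ∀ X ∈ N, (a * X).trace = (M * X).trace) :
    a.PosSemidef := by
  have hsa : IsSelfAdjoint a := by
    refine eq_of_mem_of_trace_eq (conjTranspose_mem ha) ha fun X hX => ?_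
    have h1 := h _ (conjTranspose_mem hX)
    have h2 := congrArg star h1
    rw [← Matrix.trace_conjTranspose, ← Matrix.trace_conjTranspose, Matrix.conjTranspose_mul,
      Matrix.conjTranspose_mul, Matrix.conjTranspose_conjTranspose, hM.isHermitian.eq] at h2
    change (aᴴ * X).trace = _
    rw [Matrix.trace_mul_comm, h2, Matrix.trace_mul_comm, h X hX]
  have hc : ∀ f : ℝ → ℝ, ContinuousOn f (spectrum ℝ a) := fun f => continuousOn_spectrum f a
  -- Testing with the spectral projection of the negative half-line, which lies in `N`, shows that
  -- the negative part of `a` has trace zero.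
  let χ : ℝ → ℝ := fun x => if x < 0 then 1 else 0
  have hb : cfc χ a ∈ N := cfc_mem N ha χ
  have hbb : cfc χ a = (cfc χ a)ᴴ * cfc χ a := by
    rw [show (cfc χ a)ᴴ = cfc χ a from cfc_predicate χ a, ← cfc_mul χ χ a (hc _) (hc _)]
    exact cfc_congr fun x _ => by simp [χ]
  have h1 : 0 ≤ (a * cfc χ a).trace := by
    rw [h _ hb, hbb, ← Matrix.mul_assoc, Matrix.trace_mul_comm, ← Matrix.mul_assoc]
    exact (hM.mul_mul_conjTranspose_same _).trace_nonneg
  have h2 : a * cfc χ a = cfc (fun x => x * χ x) a := by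
    rw [cfc_mul _ χ a (hc _) (hc _), cfc_id' ℝ a hsa]
  have h3 : (-(a * cfc χ a)).PosSemidef := by
    rw [h2, ← cfc_neg, ← Matrix.nonneg_iff_posSemidef]
    refine cfc_nonneg fun x _ => ?_
    by_cases hx : x < 0 <;> simp [χ, hx]
    exact hx.le
  have h4 : a * cfc χ a = 0 := by
    have h5 := h3.trace_nonneg
    rw [Matrix.trace_neg] at h5
    have h6 : (-(a * cfc χ a)).trace = 0 := by
      rw [Matrix.trace_neg, le_antisymm (neg_nonneg.1 h5) h1, neg_zero]
    exact neg_eq_zero.1 (h3.trace_eq_zero_iff.1 h6)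
  have h5 : a = cfc (fun x : ℝ => max x 0) a := by
    have h6 : cfc (fun x : ℝ => max x 0) a = cfc (fun x : ℝ => x) a - cfc (fun x => x * χ x) a := by
      rw [← cfc_sub _ _ a (hc _) (hc _)]
      refine cfc_congr fun x _ => ?_
      by_cases hx : x < 0
      · simp [χ, hx, hx.le]
      · simp [χ, hx, not_lt.1 hx]
    rw [h6, ← h2, h4, sub_zero, cfc_id' ℝ a hsa]
  rw [h5, ← Matrix.nonneg_iff_posSemidef]
  exact cfc_nonneg fun x _ => le_max_right _ _

end Factors

/-! ### Minimal central projections -/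

section CentralFamilies

variable {n : Type*} [Fintype n] [DecidableEq n] {N : StarSubalgebra ℂ (Matrix n n ℂ)}

/-- Distinct minimal central projections are orthogonal. -/
theorem IsMinimalCentral.mul_eq_zero {z w : Matrix n n ℂ} (hz : IsMinimalCentral N z)
    (hw : IsMinimalCentral N w) (hzw : z ≠ w) : z * w = 0 := by
  have hc : z * w = w * z := hz.comm hw.mem_left
  have hp : IsStarProjection (z * w) := by
    constructor
    · rw [IsIdempotentElem, Matrix.mul_assoc, ← Matrix.mul_assoc w, ← hc, Matrix.mul_assoc,
        hw.mul_self, ← Matrix.mul_assoc, hz.mul_self]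
    · change (z * w)ᴴ = z * w
      rw [Matrix.conjTranspose_mul, hz.conjTranspose, hw.conjTranspose, hc]
  have hm : z * w ∈ (N : Set (Matrix n n ℂ)) ∩ Set.centralizer N := by
    rw [← coe_inf_commutant]
    exact ⟨mul_mem hz.mem_left hw.mem_left, mul_mem hz.mem_commutant hw.mem_commutant⟩
  rcases hz.minimal _ hm hp (by rw [← Matrix.mul_assoc, hz.mul_self]) with h | h
  · exact h
  rcases hw.minimal _ hm hp (by rw [hc, ← Matrix.mul_assoc, hw.mul_self]) with h' | h'
  · exact h'
  · exact absurd (h.symm.trans h') hzw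

/-- Orthogonal nonzero projections are linearly independent, so there are finitely many of them. -/
theorem finite_setOf_isMinimalCentral (N : StarSubalgebra ℂ (Matrix n n ℂ)) :
    {z | IsMinimalCentral N z}.Finite := by
  have h : LinearIndependent ℂ (fun z : {z | IsMinimalCentral N z} => (z : Matrix n n ℂ)) := by
    rw [linearIndependent_iff']
    intro s g hg i hi
    have h1 := congrArg (fun M => (i : Matrix n n ℂ) * M) hg
    simp only [Finset.mul_sum, Matrix.mul_zero, Matrix.mul_smul] at h1
    rw [Finset.sum_eq_single i (fun j _ hj => by
      rw [i.2.mul_eq_zero j.2 (fun h => hj (Subtype.ext h.symm)), smul_zero])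
      (fun h => absurd hi h), i.2.mul_self] at h1
    exact (smul_eq_zero.1 h1).resolve_right i.2.ne_zero
  exact h.setFinite

theorem exists_isMinimalCentralFamily (N : StarSubalgebra ℂ (Matrix n n ℂ)) :
    ∃ (r : ℕ) (z : Fin r → Matrix n n ℂ), IsMinimalCentralFamily N z := by
  have := (finite_setOf_isMinimalCentral N).to_subtype
  obtain ⟨r, ⟨f⟩⟩ := Finite.exists_equiv_fin {z | IsMinimalCentral N z}
  refine ⟨r, fun p => (f.symm p : Matrix n n ℂ), ?_, fun e => ⟨fun he => ?_, ?_⟩⟩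
  · exact Subtype.val_injective.comp f.symm.injective
  · exact ⟨f ⟨e, he⟩, by simp⟩
  · rintro ⟨p, rfl⟩
    exact (f.symm p).2

namespace IsMinimalCentralFamily

variable {r : ℕ} {z : Fin r → Matrix n n ℂ}

theorem isMinimalCentral (hz : IsMinimalCentralFamily N z) (p : Fin r) :
    IsMinimalCentral N (z p) := (hz.2 _).2 ⟨p, rfl⟩

theorem mul_eq_zero (hz : IsMinimalCentralFamily N z) {p q : Fin r} (hpq : p ≠ q) :
    z p * z q = 0 :=
  (hz.isMinimalCentral p).mul_eq_zero (hz.isMinimalCentral q) fun h => hpq (hz.1 h)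

/-- A nonzero complement of the sum would contain a further minimal central projection. -/
theorem sum_eq_one (hz : IsMinimalCentralFamily N z) : ∑ p, z p = 1 := by
  by_contra hne
  set q := 1 - ∑ p, z p with hq
  have hq0 : q ≠ 0 := fun h => hne (sub_eq_zero.1 h).symm
  have hzq : ∀ p, z p * q = 0 := by
    intro p
    rw [hq, Matrix.mul_sub, Matrix.mul_one, Finset.mul_sum, Finset.sum_eq_single p
      (fun j _ hj => hz.mul_eq_zero hj.symm) (by simp), (hz.isMinimalCentral p).mul_self, sub_self]
  have hqN : q ∈ N ⊓ commutant N :=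
    sub_mem (one_mem _) (sum_mem fun p _ =>
      ⟨(hz.isMinimalCentral p).mem_left, (hz.isMinimalCentral p).mem_commutant⟩)
  have hqp : IsStarProjection q := by
    constructor
    · rw [IsIdempotentElem]
      nth_rewrite 1 [hq]
      rw [Matrix.sub_mul, Matrix.one_mul, Finset.sum_mul, Finset.sum_eq_zero fun p _ => hzq p,
        sub_zero]
    · change qᴴ = q
      rw [hq, Matrix.conjTranspose_sub, Matrix.conjTranspose_one, Matrix.conjTranspose_sum]
      simp only [(hz.isMinimalCentral _).conjTranspose]
  obtain ⟨e, he, hqe⟩ := exists_isMinimalProjection_le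
    (N := ((N ⊓ commutant N : StarSubalgebra ℂ (Matrix n n ℂ)) : Set (Matrix n n ℂ))) hqN hqp hq0
  rw [coe_inf_commutant] at he
  obtain ⟨p, rfl⟩ := (hz.2 e).1 he
  apply he.ne_zero
  have h1 : z p * q * z p = 0 := by rw [hzq, Matrix.zero_mul]
  rwa [Matrix.mul_assoc, hqe, he.mul_self] at h1

end IsMinimalCentralFamily

end CentralFamilies

/-! ### Functionals invariant under a common conditional expectation -/

section Expectation

variable {n : Type*} [Fintype n] [DecidableEq n]

open scoped MatrixOrder Matrix.Norms.L2Operator in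
theorem exists_eq_conjTranspose_mul_self {D : Matrix n n ℂ} (hD : D.PosSemidef) :
    ∃ B : Matrix n n ℂ, D = Bᴴ * B :=
  CStarAlgebra.nonneg_iff_eq_star_mul_self.1 (Matrix.nonneg_iff_posSemidef.2 hD)

/-- A positive definite matrix defines a faithful functional. -/
theorem eq_zero_of_trace_mul_eq_zero {D X : Matrix n n ℂ} (hD : D.PosDef)
    (h : (D * (Xᴴ * X)).trace = 0) : X = 0 := by
  obtain ⟨B, hB⟩ := exists_eq_conjTranspose_mul_self hD.posSemidef
  have h1 : X * Bᴴ = 0 := by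
    apply Matrix.trace_conjTranspose_mul_self_eq_zero_iff.1
    rw [Matrix.conjTranspose_mul, Matrix.conjTranspose_conjTranspose, Matrix.mul_assoc,
      Matrix.trace_mul_comm, Matrix.mul_assoc, Matrix.mul_assoc, ← hB, ← h,
      Matrix.trace_mul_comm D, Matrix.mul_assoc]
  have h2 : X * D = 0 := by rw [hB, ← Matrix.mul_assoc, h1, Matrix.zero_mul]
  obtain ⟨u, hu⟩ := hD.isUnit
  rw [← hu] at h2
  exact (Units.mul_left_eq_zero u).1 h2

theorem eq_zero_of_posSemidef_of_trace_mul_eq_zero {D X : Matrix n n ℂ} (hD : D.PosDef)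
    (hX : X.PosSemidef) (h : (D * X).trace = 0) : X = 0 := by
  obtain ⟨B, rfl⟩ := exists_eq_conjTranspose_mul_self hX
  rw [eq_zero_of_trace_mul_eq_zero hD h, Matrix.mul_zero]

/-- The functionals with densities `D s` are invariant under one and the same conditional
expectation onto `N`: every `X` has an image `c` in `N` that it may be replaced with in the
functionals, between two elements of `N`. -/
def AdmitsExpectation {ι : Type*} (N : StarSubalgebra ℂ (Matrix n n ℂ))
    (D : ι → Matrix n n ℂ) : Prop :=
  ∀ X, ∃ c ∈ N, ∀ s, ∀ Y ∈ N, ∀ Y' ∈ N, (D s * (Y * X * Y')).trace = (D s * (Y * c * Y')).trace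

variable {ι : Type*} {N : StarSubalgebra ℂ (Matrix n n ℂ)} {D : ι → Matrix n n ℂ}
  {z : Matrix n n ℂ}

namespace AdmitsExpectation

/-- The densities commute with the center of `N`, since `z X` and `X z` have expectations with equal
values in the functionals. -/
theorem comm (hE : AdmitsExpectation N D) (hz : IsMinimalCentral N z) (s : ι) :
    z * D s = D s * z := by
  refine eq_of_trace_mul_eq (V := ⊤) (fun _ _ => trivial) trivial trivial fun X _ => ?_
  obtain ⟨c, hc, h⟩ := hE X
  have h1 := h s z hz.mem_left 1 (one_mem N)
  have h2 := h s 1 (one_mem N) z hz.mem_left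
  rw [Matrix.mul_one, Matrix.mul_one, hz.comm hc] at h1
  rw [Matrix.one_mul, Matrix.one_mul] at h2
  rw [Matrix.mul_assoc (D s), h1, ← h2, Matrix.mul_assoc, Matrix.trace_mul_comm, Matrix.mul_assoc]

/-- The functionals split as products on `z N N'`, with a second factor that does not depend
on the index. -/
theorem exists_trace_eq (hE : AdmitsExpectation N D) (hD : ∀ s, (D s).PosDef) [Nonempty ι]
    (hz : IsMinimalCentral N z) {Y : Matrix n n ℂ} (hY : Y ∈ commutant N) :
    ∃ ω : ℂ, ∀ s, ∀ X ∈ N, (D s * (X * Y * z)).trace = ω * (D s * (X * z)).trace := by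
  obtain ⟨c, hc, h⟩ := hE Y
  have hY' := mem_commutant.1 hY
  -- The expectation of an element of `N'` is central, since the functionals are faithful.
  have hc' : c ∈ commutant N := by
    refine mem_commutant.2 fun X hX => ?_
    obtain ⟨s⟩ := ‹Nonempty ι›
    refine sub_eq_zero.1 (eq_zero_of_trace_mul_eq_zero (hD s) ?_)
    set W := X * c - c * X with hW
    have hWN : Wᴴ ∈ N := conjTranspose_mem (sub_mem (mul_mem hX hc) (mul_mem hc hX))
    have h1 := h s _ (mul_mem hWN hX) 1 (one_mem N)
    have h2 := h s _ hWN _ hX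
    rw [Matrix.mul_one, Matrix.mul_one, Matrix.mul_assoc, Matrix.mul_assoc] at h1
    rw [Matrix.mul_assoc, Matrix.mul_assoc] at h2
    rw [hW, Matrix.mul_sub, ← hW, Matrix.mul_sub, Matrix.trace_sub, ← h1, ← h2, hY' X hX, sub_self]
  obtain ⟨κ, hκ⟩ := hz.exists_mul_eq_smul hc hc'
  refine ⟨κ, fun s X hX => ?_⟩
  rw [h s X hX z hz.mem_left, Matrix.mul_assoc, ← hz.comm hc, hκ, Matrix.mul_smul,
    Matrix.mul_smul, Matrix.trace_smul, smul_eq_mul]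

end AdmitsExpectation

theorem trace_mul_pos (hD : ∀ s, (D s).PosDef) (hz : IsMinimalCentral N z) (s : ι) :
    0 < (D s * z).trace := by
  have hzz : zᴴ * z = z := by rw [hz.conjTranspose, hz.mul_self]
  refine lt_of_le_of_ne ?_ fun h => hz.ne_zero (eq_zero_of_trace_mul_eq_zero (hD s) ?_)
  · rw [← hzz, ← Matrix.mul_assoc, Matrix.trace_mul_comm, ← Matrix.mul_assoc]
    exact ((hD s).posSemidef.mul_mul_conjTranspose_same z).trace_nonneg
  · rw [hzz, ← h]

/-- The density `D s`, cut down by `z`, is a multiple of the product of its projections onto `N`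
and `N'`: both sides define the same functional on `z N N'`, which spans the corner at `z`. -/
theorem AdmitsExpectation.mul_eq (hE : AdmitsExpectation N D) (hD : ∀ s, (D s).PosDef)
    (hz : IsMinimalCentral N z) (s : ι) {a b : Matrix n n ℂ} (ha : a ∈ N)
    (haD : ∀ X ∈ N, (a * X).trace = (D s * X).trace) (hb : b ∈ commutant N)
    (hbD : ∀ Y ∈ commutant N, (b * Y).trace = (D s * Y).trace) :
    (D s * z).trace • (D s * z) = z.trace • (a * b * z) := by
  have : Nonempty ι := ⟨s⟩
  have hcomm : ∀ X ∈ N, ∀ Y ∈ commutant N, X * Y = Y * X := fun X hX Y hY =>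
    mem_commutant.1 hY X hX
  have hzD := hE.comm hz s
  set W := (D s * z).trace • (D s * z) - z.trace • (a * b * z) with hW
  -- `W` lies in the corner at `z`, so it vanishes once it is orthogonal to `N N'`.
  have hzW : z * W * z = W := by
    have h1 : z * (a * b) = a * b * z := by
      rw [← Matrix.mul_assoc, hz.comm ha, Matrix.mul_assoc, hz.comm' hb, Matrix.mul_assoc]
    simp only [hW, Matrix.mul_sub, Matrix.sub_mul, Matrix.mul_smul, Matrix.smul_mul]
    rw [← Matrix.mul_assoc z, hzD, ← Matrix.mul_assoc z (a * b), h1, Matrix.mul_assoc (D s),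
      hz.mul_self, Matrix.mul_assoc (D s), hz.mul_self, Matrix.mul_assoc (a * b), hz.mul_self,
      Matrix.mul_assoc (a * b), hz.mul_self]
  have hprod : ∀ X ∈ N, ∀ Y ∈ commutant N, (W * (X * Y)).trace = 0 := by
    intro X hX Y hY
    obtain ⟨ω, hω⟩ := hE.exists_trace_eq hD hz hY
    have h1 := hω s 1 (one_mem N)
    rw [Matrix.one_mul, Matrix.one_mul] at h1
    have h2 := hz.trace_mul_mul (mul_mem ha hX) (mul_mem hb hY)
    have h3 : z * (X * Y) = X * Y * z := by
      rw [← Matrix.mul_assoc, hz.comm hX, Matrix.mul_assoc, hz.comm' hY, Matrix.mul_assoc]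
    have h4 : a * b * z * (X * Y) = a * X * (b * Y) * z := by
      rw [Matrix.mul_assoc (a * b), h3]
      calc a * b * (X * Y * z) = a * (b * X) * (Y * z) := by noncomm_ring
        _ = _ := by rw [← hcomm X hX b hb]; noncomm_ring
    rw [hW, Matrix.sub_mul, Matrix.smul_mul, Matrix.smul_mul, Matrix.trace_sub, Matrix.trace_smul,
      Matrix.trace_smul, smul_eq_mul, smul_eq_mul, h4, Matrix.mul_assoc (D s), h3, hω s X hX,
      mul_comm z.trace, h2, Matrix.mul_assoc a, Matrix.mul_assoc b,
      haD _ (mul_mem hX hz.mem_left), hbD _ (mul_mem hY hz.mem_commutant), h1]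
    ring
  have hspan : ∀ U ∈ Submodule.span ℂ {W | ∃ X ∈ N, ∃ Y ∈ commutant N, W = X * Y},
      (W * U).trace = 0 := by
    intro U hU
    induction hU using Submodule.span_induction with
    | mem U hU =>
      obtain ⟨X, hX, Y, hY, rfl⟩ := hU
      exact hprod X hX Y hY
    | zero => simp
    | add u v _ _ hu hv => rw [Matrix.mul_add, Matrix.trace_add, hu, hv, add_zero]
    | smul c u _ hu => rw [Matrix.mul_smul, Matrix.trace_smul, hu, smul_zero]
  have hW0 : W = 0 := by
    apply Matrix.trace_mul_conjTranspose_self_eq_zero_iff.1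
    have h1 : Wᴴ = z * Wᴴ * z := by
      conv_lhs => rw [← hzW]
      rw [Matrix.conjTranspose_mul, Matrix.conjTranspose_mul, hz.conjTranspose, Matrix.mul_assoc]
    rw [h1]
    exact hspan _ (hz.corner_mem_span _)
  exact sub_eq_zero.1 hW0

omit [DecidableEq n] in
theorem posSemidef_mul_of_comm {a z : Matrix n n ℂ} (ha : a.PosSemidef) (hz : z * z = z)
    (hzh : zᴴ = z) (h : z * a = a * z) : (a * z).PosSemidef := by
  have h1 := ha.mul_mul_conjTranspose_same z
  rwa [hzh, h, Matrix.mul_assoc, hz] at h1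

/-- In the order of `ℂ`, positive numbers are real. -/
theorem div_nonneg_of_pos {x y : ℂ} (hx : 0 < x) (hy : 0 < y) : 0 ≤ x / y := by
  rw [Complex.pos_iff] at hx hy
  rw [Complex.ext (z := x) (w := (x.re : ℂ)) rfl (by simpa using hx.2.symm),
    Complex.ext (z := y) (w := (y.re : ℂ)) rfl (by simpa using hy.2.symm), ← Complex.ofReal_div]
  exact Complex.zero_le_real.2 (div_nonneg hx.1.le hy.1.le)

/-- Faithful densities with a common conditional expectation onto `N` split over every minimal
central projection `z` of `N` into densities of `z N` and a density of `z N'` that does not depend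
on the index. The last clause identifies the former as the restrictions of the functionals
to `z N`. -/
theorem AdmitsExpectation.exists_isDensityIn (hE : AdmitsExpectation N D)
    (hD : ∀ s, (D s).PosDef) [Nonempty ι] (hz : IsMinimalCentral N z) :
    ∃ (S : ι → Matrix n n ℂ) (R : Matrix n n ℂ), (∀ s, IsDensityIn (corner z N) (S s)) ∧
      IsDensityIn (corner z (commutant N)) R ∧
      (∀ s, D s * z = (D s * z).trace • (S s * R)) ∧
      ∀ s, ∀ e, IsMinimalProjection (N : Set (Matrix n n ℂ)) e → z * e = e → ∀ X ∈ N,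
        (D s * z).trace * (S s * X).trace = e.trace * (D s * (X * z)).trace := by
  obtain ⟨s₀⟩ := id ‹Nonempty ι›
  have hpos := trace_mul_pos hD hz
  have hzp : IsStarProjection z := hz.isStarProjection
  obtain ⟨e, he, hze⟩ := exists_isMinimalProjection_le (N := (N : Set (Matrix n n ℂ)))
    hz.mem_left hzp hz.ne_zero
  obtain ⟨f, hf, hzf⟩ := exists_isMinimalProjection_le (N := (commutant N : Set (Matrix n n ℂ)))
    hz.mem_commutant hzp hz.ne_zero
  -- All minimal projections of `z N` have the same trace, as their product with the trace of `f`
  -- is that of `z`; likewise for `z N'`.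
  have htt := hz.trace_mul_trace he hze hf hzf
  have hte : ∀ e', IsMinimalProjection (N : Set (Matrix n n ℂ)) e' → z * e' = e' →
      e'.trace = e.trace := fun e' he' hze' =>
    mul_right_cancel₀ hf.trace_pos.ne' ((hz.trace_mul_trace he' hze' hf hzf).trans htt.symm)
  have htf : ∀ f', IsMinimalProjection (commutant N : Set (Matrix n n ℂ)) f' → z * f' = f' →
      f'.trace = f.trace := fun f' hf' hzf' =>
    mul_left_cancel₀ he.trace_pos.ne' ((hz.trace_mul_trace he hze hf' hzf').trans htt.symm)
  choose a ha haD using fun s => exists_mem_trace_eq N (D s)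
  choose b hb hbD using fun s => exists_mem_trace_eq (commutant N) (D s)
  -- Up to normalization, the projection of `D s` onto `z N'` does not depend on `s`.
  have hbs : ∀ s, (D s * z).trace • (b s₀ * z) = (D s₀ * z).trace • (b s * z) := by
    intro s
    refine eq_of_mem_of_trace_eq (N := commutant N)
      (StarSubalgebra.smul_mem _ (mul_mem (hb _) hz.mem_commutant) _)
      (StarSubalgebra.smul_mem _ (mul_mem (hb _) hz.mem_commutant) _) fun Y hY => ?_
    obtain ⟨ω, hω⟩ := hE.exists_trace_eq hD hz hY
    have h1 : ∀ s, (b s * z * Y).trace = ω * (D s * z).trace := by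
      intro s
      have := hω s 1 (one_mem N)
      rw [Matrix.one_mul, Matrix.one_mul] at this
      rw [Matrix.mul_assoc, hbD s _ (mul_mem hz.mem_commutant hY), hz.comm' hY, this]
    rw [Matrix.smul_mul, Matrix.smul_mul, Matrix.trace_smul, Matrix.trace_smul, h1, h1,
      smul_eq_mul, smul_eq_mul]
    ring
  have haz : ∀ s, (a s * z).trace = (D s * z).trace := fun s => haD s z hz.mem_left
  have hbz : ∀ s, (b s * z).trace = (D s * z).trace := fun s => hbD s z hz.mem_commutant
  refine ⟨fun s => (e.trace / (D s * z).trace) • (a s * z),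
    (f.trace / (D s₀ * z).trace) • (b s₀ * z), fun s => ⟨?_, ?_, ?_⟩, ⟨?_, ?_, ?_⟩, fun s => ?_,
    fun s e' he' hze' X hX => ?_⟩
  · exact ⟨(e.trace / (D s * z).trace) • a s, StarSubalgebra.smul_mem _ (ha s) _, by
      simp only [Matrix.mul_smul, hz.comm (ha s)]⟩
  · exact (posSemidef_mul_of_comm (posSemidef_of_trace_eq (ha s) (hD s).posSemidef (haD s))
      hz.mul_self hz.conjTranspose (hz.comm (ha s))).smul (div_nonneg_of_pos he.trace_pos (hpos s))
  · intro e' he'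
    rw [isMinimalProjection_corner_iff hz.mem_left hz.mul_self] at he'
    rw [Matrix.trace_smul, haz, smul_eq_mul, div_mul_cancel₀ _ (hpos s).ne', hte e' he'.1 he'.2]
  · exact ⟨(f.trace / (D s₀ * z).trace) • b s₀, StarSubalgebra.smul_mem _ (hb s₀) _, by
      simp only [Matrix.mul_smul, hz.comm' (hb s₀)]⟩
  · exact (posSemidef_mul_of_comm (posSemidef_of_trace_eq (hb s₀) (hD s₀).posSemidef (hbD s₀))
      hz.mul_self hz.conjTranspose (hz.comm' (hb s₀))).smul
        (div_nonneg_of_pos hf.trace_pos (hpos s₀))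
  · intro f' hf'
    rw [isMinimalProjection_corner_iff hz.mem_commutant hz.mul_self] at hf'
    rw [Matrix.trace_smul, hbz, smul_eq_mul, div_mul_cancel₀ _ (hpos s₀).ne', htf f' hf'.1 hf'.2]
  · have h1 := hE.mul_eq hD hz s (ha s) (haD s) (hb s) (hbD s)
    have h2 : a s * z * (b s₀ * z) = a s * (b s₀ * z) := by
      rw [Matrix.mul_assoc, ← Matrix.mul_assoc z, hz.comm' (hb s₀), Matrix.mul_assoc, hz.mul_self]
    have h3 : (D s * z).trace • (a s * z * (b s₀ * z)) =
        (D s₀ * z).trace • (a s * b s * z) := by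
      rw [h2, ← Matrix.mul_smul, hbs, Matrix.mul_smul, Matrix.mul_assoc]
    rw [Matrix.smul_mul, Matrix.mul_smul, smul_smul, smul_smul]
    have h4 : ∀ U V : Matrix n n ℂ, (D s * z).trace • U = (D s * z).trace • V → U = V :=
      fun U V h => smul_right_injective _ (hpos s).ne' h
    apply h4
    rw [h1, smul_smul, mul_comm (D s * z).trace (_ * _), ← smul_smul _ (D s * z).trace, h3,
      smul_smul, ← htt]
    congr 1
    have := (hpos s).ne'
    have := (hpos s₀).ne'
    field_simp
  · rw [hte e' he' hze', Matrix.smul_mul, Matrix.trace_smul, smul_eq_mul, Matrix.mul_assoc,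
      haD s _ (mul_mem hz.mem_left hX), hz.comm hX]
    have := (hpos s).ne'
    field_simp

end Expectation

/-! ### 2-positive maps and their adjoints -/

section TwoPositive

variable {m n : Type*} [Fintype m] [Fintype n] [DecidableEq m] [DecidableEq n]
  {T : Matrix m m ℂ →ₗ[ℂ] Matrix n n ℂ}

/-- The Schur complement criterion for a lower right corner equal to one. -/
theorem posSemidef_fromBlocks_one {A B : Matrix m m ℂ} (h : (A - B * Bᴴ).PosSemidef) :
    (Matrix.fromBlocks A B Bᴴ (1 : Matrix m m ℂ)).PosSemidef := by
  have : Invertible (1 : Matrix m m ℂ) := invertibleOne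
  exact (Matrix.PosDef.fromBlocks₂₂ A B Matrix.PosDef.one).2 (by simpa using h)

omit [Fintype n] [DecidableEq n] in
theorem IsTwoPositive.map_conjTranspose (hT : IsTwoPositive T) (X : Matrix m m ℂ) :
    T Xᴴ = (T X)ᴴ := by
  have h := hT _ _ _ _ (posSemidef_fromBlocks_one (A := X * Xᴴ) (B := X)
    (by rw [sub_self]; exact Matrix.PosSemidef.zero))
  exact (Matrix.isHermitian_fromBlocks_iff.1 h.isHermitian).2.1.symm

omit [Fintype n] [DecidableEq n] in
theorem IsTwoPositive.map_posSemidef (hT : IsTwoPositive T) {X : Matrix m m ℂ}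
    (hX : X.PosSemidef) : (T X).PosSemidef := by
  have h := hT _ _ _ _ (posSemidef_fromBlocks_one (A := X) (B := 0) (by simpa using hX))
  exact h.submatrix Sum.inl

/-- The Schwarz inequality for unital 2-positive maps. -/
theorem IsTwoPositive.schwarz (hT : IsTwoPositive T) (h1 : T 1 = 1) (X : Matrix m m ℂ) :
    (T (Xᴴ * X) - (T X)ᴴ * T X).PosSemidef := by
  have h := hT _ _ _ _ (posSemidef_fromBlocks_one (A := Xᴴ * X) (B := Xᴴ)
    (by rw [Matrix.conjTranspose_conjTranspose, sub_self]; exact Matrix.PosSemidef.zero))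
  have : Invertible (1 : Matrix n n ℂ) := invertibleOne
  rw [h1, Matrix.conjTranspose_conjTranspose, hT.map_conjTranspose] at h
  nth_rewrite 2 [← Matrix.conjTranspose_conjTranspose (T X)] at h
  have h2 := (Matrix.PosDef.fromBlocks₂₂ _ _ Matrix.PosDef.one).1 h
  simpa using h2

omit [DecidableEq n] in
/-- A Hermitian direction along which a positive matrix stays positive for all times vanishes. -/
theorem eq_zero_of_posSemidef_add_smul {P K : Matrix n n ℂ} (hK : K.IsHermitian)
    (h : ∀ t : ℝ, (P + (t : ℂ) • K).PosSemidef) : K = 0 := by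
  have h0 : ∀ x : n → ℂ, star x ⬝ᵥ (K *ᵥ x) = 0 := by
    intro x
    have h1 : ∀ t : ℝ, 0 ≤ (star x ⬝ᵥ (P *ᵥ x)).re + t * (star x ⬝ᵥ (K *ᵥ x)).re := by
      intro t
      have h2 := (h t).dotProduct_mulVec_nonneg x
      rw [Matrix.add_mulVec, Matrix.smul_mulVec, dotProduct_add, dotProduct_smul] at h2
      simpa using (Complex.le_def.1 h2).1
    have h3 : (star x ⬝ᵥ (K *ᵥ x)).re = 0 := by
      by_contra hne
      have h4 := h1 (-((star x ⬝ᵥ (P *ᵥ x)).re + 1) / (star x ⬝ᵥ (K *ᵥ x)).re)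
      rw [div_mul_cancel₀ _ hne] at h4
      linarith
    have h5 : (star x ⬝ᵥ (K *ᵥ x)).im = 0 := hK.im_star_dotProduct_mulVec_self x
    exact Complex.ext h3 h5
  have hp : K.PosSemidef := Matrix.PosSemidef.of_dotProduct_mulVec_nonneg hK fun x => (h0 x).ge
  have hn : (-K).PosSemidef := Matrix.PosSemidef.of_dotProduct_mulVec_nonneg hK.neg fun x => by
    rw [Matrix.neg_mulVec, dotProduct_neg, h0, neg_zero]
  refine hp.trace_eq_zero_iff.1 (le_antisymm ?_ hp.trace_nonneg)
  have := hn.trace_nonneg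
  rwa [Matrix.trace_neg, Left.nonneg_neg_iff] at this

/-- Equality in the Schwarz inequality at `X` makes the map multiplicative at `X`: the
inequality at `Y + c X` is affine in `c`. -/
theorem IsTwoPositive.map_mul (hT : IsTwoPositive T) (h1 : T 1 = 1) {X : Matrix m m ℂ}
    (hX : T (Xᴴ * X) = (T X)ᴴ * T X) (Y : Matrix m m ℂ) : T (Y * X) = T Y * T X := by
  set Q := T (Yᴴᴴ * X) - (T Yᴴ)ᴴ * T X with hQ
  have hQs : Qᴴ = T (Xᴴ * Yᴴ) - (T X)ᴴ * T Yᴴ := by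
    rw [hQ, Matrix.conjTranspose_sub, ← hT.map_conjTranspose, Matrix.conjTranspose_mul,
      Matrix.conjTranspose_mul, Matrix.conjTranspose_conjTranspose,
      Matrix.conjTranspose_conjTranspose]
  have key : ∀ c : ℂ, (T (Yᴴᴴ * Yᴴ) - (T Yᴴ)ᴴ * T Yᴴ + (c • Q + star c • Qᴴ)).PosSemidef := by
    intro c
    have h := hT.schwarz h1 (Yᴴ + c • X)
    have e : T ((Yᴴ + c • X)ᴴ * (Yᴴ + c • X)) - (T (Yᴴ + c • X))ᴴ * T (Yᴴ + c • X) =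
        T (Yᴴᴴ * Yᴴ) - (T Yᴴ)ᴴ * T Yᴴ + (c • Q + star c • Qᴴ) +
          (star c * c) • (T (Xᴴ * X) - (T X)ᴴ * T X) := by
      rw [hQs, hQ]
      simp only [Matrix.conjTranspose_add, Matrix.conjTranspose_smul, Matrix.add_mul,
        Matrix.mul_add, Matrix.smul_mul, Matrix.mul_smul, map_add, map_smul]
      module
    rw [e, hX, sub_self, smul_zero, add_zero] at h
    exact h
  -- Real and imaginary `c` show that the two Hermitian parts of `Q` vanish.
  have hre : Q + Qᴴ = 0 := by
    refine eq_zero_of_posSemidef_add_smul (P := T (Yᴴᴴ * Yᴴ) - (T Yᴴ)ᴴ * T Yᴴ)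
      (Matrix.isHermitian_add_transpose_self Q) fun t => ?_
    have := key t
    rwa [show star (t : ℂ) = t from Complex.conj_ofReal t, ← smul_add] at this
  have him : Complex.I • (Q - Qᴴ) = 0 := by
    refine eq_zero_of_posSemidef_add_smul
      (P := T (Yᴴᴴ * Yᴴ) - (T Yᴴ)ᴴ * T Yᴴ) ?_ fun t => ?_
    · change (Complex.I • (Q - Qᴴ))ᴴ = _
      rw [Matrix.conjTranspose_smul, Matrix.conjTranspose_sub, Matrix.conjTranspose_conjTranspose,
        show star Complex.I = -Complex.I from Complex.conj_I, neg_smul, ← smul_neg, neg_sub]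
    · have := key (t * Complex.I)
      rwa [show star ((t : ℂ) * Complex.I) = -(t * Complex.I) by simp, neg_smul,
        ← sub_eq_add_neg, ← smul_sub, mul_smul] at this
  have h2 : Q - Qᴴ = 0 := (smul_eq_zero.1 him).resolve_left Complex.I_ne_zero
  have h3 : Q = 0 := by
    have h4 : (2 : ℂ) • Q = (Q + Qᴴ) + (Q - Qᴴ) := by rw [two_smul]; abel
    rw [hre, h2, add_zero] at h4
    exact (smul_eq_zero.1 h4).resolve_left two_ne_zero
  rw [hQ, Matrix.conjTranspose_conjTranspose, hT.map_conjTranspose,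
    Matrix.conjTranspose_conjTranspose] at h3
  exact sub_eq_zero.1 h3

omit [DecidableEq n] in
theorem trace_mul_nonneg {A B : Matrix n n ℂ} (hA : A.PosSemidef)
    (hB : B.PosSemidef) : 0 ≤ (A * B).trace := by
  classical
  obtain ⟨C, rfl⟩ := exists_eq_conjTranspose_mul_self hB
  rw [← Matrix.mul_assoc, Matrix.trace_mul_comm, ← Matrix.mul_assoc]
  exact (hA.mul_mul_conjTranspose_same C).trace_nonneg

omit [DecidableEq n] in
/-- The cone of positive matrices is self-dual. -/
theorem posSemidef_of_trace_mul_nonneg {M : Matrix n n ℂ}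
    (hM : M.IsHermitian)
    (h : ∀ A : Matrix n n ℂ, A.PosSemidef → 0 ≤ (A * M).trace) : M.PosSemidef := by
  refine Matrix.PosSemidef.of_dotProduct_mulVec_nonneg hM fun x => ?_
  have h1 := h _ (Matrix.posSemidef_vecMulVec_self_star x)
  rwa [Matrix.trace_mul_comm, Matrix.mul_vecMulVec, Matrix.trace_vecMulVec, dotProduct_comm] at h1

omit [DecidableEq n] in
theorem trace_fromBlocks_mul (A B C D A' B' C' D' : Matrix n n ℂ) :
    (Matrix.fromBlocks A B C D * Matrix.fromBlocks A' B' C' D').trace =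
      (A * A').trace + (B * C').trace + ((C * B').trace + (D * D').trace) := by
  rw [Matrix.fromBlocks_multiply]
  simp [Matrix.trace, Fintype.sum_sum_type, Finset.sum_add_distrib]

/-- The adjoint relation without conjugate transposes. -/
theorem trace_mul_hsAdjoint (hT : IsTwoPositive T) (A : Matrix m m ℂ) (X : Matrix n n ℂ) :
    (A * hsAdjoint T X).trace = (T A * X).trace := by
  have h := trace_hsAdjoint T Aᴴ X
  rwa [hT.map_conjTranspose, Matrix.conjTranspose_conjTranspose,
    Matrix.conjTranspose_conjTranspose] at h

theorem hsAdjoint_conjTranspose (hT : IsTwoPositive T) (X : Matrix n n ℂ) :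
    hsAdjoint T Xᴴ = (hsAdjoint T X)ᴴ := by
  refine eq_of_trace_mul_eq (V := ⊤) (fun _ _ => trivial) trivial trivial fun A _ => ?_
  have h := congrArg star (trace_mul_hsAdjoint hT Aᴴ X)
  rw [← Matrix.trace_conjTranspose, ← Matrix.trace_conjTranspose, Matrix.conjTranspose_mul,
    Matrix.conjTranspose_mul, hT.map_conjTranspose, Matrix.conjTranspose_conjTranspose,
    Matrix.conjTranspose_conjTranspose] at h
  rw [h, Matrix.trace_mul_comm, trace_mul_hsAdjoint hT, Matrix.trace_mul_comm]

theorem hsAdjoint_one (hT : IsTwoPositive T) (hTr : IsTracePreserving T) :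
    hsAdjoint T 1 = 1 := by
  refine eq_of_trace_mul_eq (V := ⊤) (fun _ _ => trivial) trivial trivial fun A _ => ?_
  rw [Matrix.trace_mul_comm, trace_mul_hsAdjoint hT, Matrix.mul_one, hTr A, Matrix.one_mul]

/-- The cone of positive operator matrices is self-dual, so the adjoint of a 2-positive map
is 2-positive. -/
theorem IsTwoPositive.hsAdjoint (hT : IsTwoPositive T) :
    IsTwoPositive (CoarseGraining.hsAdjoint T) := by
  intro A B C D h
  obtain ⟨hA, hBC, hCB, hD⟩ := Matrix.isHermitian_fromBlocks_iff.1 h.isHermitian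
  have hherm : ∀ X Y : Matrix n n ℂ, Xᴴ = Y →
      (CoarseGraining.hsAdjoint T X)ᴴ = CoarseGraining.hsAdjoint T Y := fun X Y hXY => by
    rw [← hsAdjoint_conjTranspose hT, hXY]
  refine posSemidef_of_trace_mul_nonneg (Matrix.isHermitian_fromBlocks_iff.2
    ⟨hherm _ _ hA, hherm _ _ hBC, hherm _ _ hCB, hherm _ _ hD⟩) fun M hM => ?_
  rw [← Matrix.fromBlocks_toBlocks M] at hM ⊢
  have h1 := trace_mul_nonneg (hT _ _ _ _ hM) h
  rw [trace_fromBlocks_mul] at h1 ⊢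
  simpa only [trace_mul_hsAdjoint hT] using h1

end TwoPositive

/-! ### Fixed point algebras of reversible pairs -/

section Reversible

variable {m n : Type*} [Fintype m] [Fintype n] [DecidableEq m] [DecidableEq n] {ι : Type*}

/-- Unital 2-positive maps `α` and `γ` in opposite directions that intertwine two families of
faithful functionals, given by their densities `D s` and `E s`. -/
structure IsReversiblePair (α : Matrix n n ℂ →ₗ[ℂ] Matrix m m ℂ)
    (γ : Matrix m m ℂ →ₗ[ℂ] Matrix n n ℂ) (D : ι → Matrix m m ℂ) (E : ι → Matrix n n ℂ) :
    Prop where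
  left_pos : IsTwoPositive α
  right_pos : IsTwoPositive γ
  left_one : α 1 = 1
  right_one : γ 1 = 1
  left_posDef : ∀ s, (D s).PosDef
  right_posDef : ∀ s, (E s).PosDef
  trace_left : ∀ s X, (D s * α X).trace = (E s * X).trace
  trace_right : ∀ s Y, (E s * γ Y).trace = (D s * Y).trace

namespace IsReversiblePair

variable {α : Matrix n n ℂ →ₗ[ℂ] Matrix m m ℂ} {γ : Matrix m m ℂ →ₗ[ℂ] Matrix n n ℂ}
  {D : ι → Matrix m m ℂ} {E : ι → Matrix n n ℂ}

theorem symm (h : IsReversiblePair α γ D E) : IsReversiblePair γ α E D :=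
  ⟨h.right_pos, h.left_pos, h.right_one, h.left_one, h.right_posDef, h.left_posDef,
    h.trace_right, h.trace_left⟩

variable [Nonempty ι]

/-- At a fixed point of `γ ∘ α` both Schwarz inequalities are equalities, since the functionals
are faithful, so `α` is multiplicative there. -/
theorem map_mul (h : IsReversiblePair α γ D E) {X : Matrix n n ℂ} (hX : γ (α X) = X)
    (Y : Matrix n n ℂ) : α (Y * X) = α Y * α X := by
  obtain ⟨s⟩ := ‹Nonempty ι›
  refine h.left_pos.map_mul h.left_one ?_ Y
  have hP := h.left_pos.schwarz h.left_one X
  refine sub_eq_zero.1 (eq_zero_of_posSemidef_of_trace_mul_eq_zero (h.left_posDef s) hP ?_)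
  have h1 := trace_mul_nonneg (h.right_posDef s).posSemidef
    (h.right_pos.schwarz h.right_one (α X))
  refine le_antisymm ?_ (trace_mul_nonneg (h.left_posDef s).posSemidef hP)
  rw [hX, Matrix.mul_sub, Matrix.trace_sub, h.trace_right] at h1
  rw [Matrix.mul_sub, Matrix.trace_sub, h.trace_left]
  rw [← neg_nonneg, neg_sub]
  exact h1

theorem map_mul' (h : IsReversiblePair α γ D E) {X : Matrix n n ℂ} (hX : γ (α X) = X)
    (Y : Matrix n n ℂ) : α (X * Y) = α X * α Y := by
  have hX' : γ (α Xᴴ) = Xᴴ := by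
    rw [h.left_pos.map_conjTranspose, h.right_pos.map_conjTranspose, hX]
  have h1 := h.map_mul hX' Yᴴ
  rw [← Matrix.conjTranspose_mul, h.left_pos.map_conjTranspose, h.left_pos.map_conjTranspose,
    h.left_pos.map_conjTranspose, ← Matrix.conjTranspose_mul] at h1
  exact Matrix.conjTranspose_injective h1

/-- The fixed points of `γ ∘ α` form a *-algebra. -/
noncomputable def fixedAlgebra (h : IsReversiblePair α γ D E) :
    StarSubalgebra ℂ (Matrix n n ℂ) where
  carrier := {X | γ (α X) = X}
  mul_mem' {X Y} hX hY := by
    have hX' : γ (α X) = X := hX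
    have hY' : γ (α Y) = Y := hY
    change γ (α (X * Y)) = X * Y
    rw [h.map_mul hY', h.symm.map_mul (congrArg α hY'), hX', hY']
  add_mem' {X Y} hX hY := by
    change γ (α (X + Y)) = X + Y
    rw [map_add, map_add, show γ (α X) = X from hX, show γ (α Y) = Y from hY]
  algebraMap_mem' c := by
    change γ (α (algebraMap ℂ _ c)) = _
    rw [Algebra.algebraMap_eq_smul_one, map_smul, map_smul, h.left_one, h.right_one]
  star_mem' {X} hX := by
    change γ (α Xᴴ) = Xᴴ
    rw [h.left_pos.map_conjTranspose, h.right_pos.map_conjTranspose, show γ (α X) = X from hX]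

theorem map_mem (h : IsReversiblePair α γ D E) {X : Matrix n n ℂ} (hX : X ∈ h.fixedAlgebra) :
    α X ∈ h.symm.fixedAlgebra := congrArg α hX

theorem image_fixedAlgebra (h : IsReversiblePair α γ D E) :
    α '' h.fixedAlgebra = h.symm.fixedAlgebra := by
  ext Y
  constructor
  · rintro ⟨X, hX, rfl⟩
    exact h.map_mem hX
  · intro hY
    exact ⟨γ Y, h.symm.map_mem hY, hY⟩

/-- The range of `1 - γ ∘ α` is annihilated by the functionals, also after multiplication by
fixed points, so it is a complement of the fixed point algebra. -/
theorem admitsExpectation (h : IsReversiblePair α γ D E) :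
    AdmitsExpectation h.fixedAlgebra E := by
  let f : Matrix n n ℂ →ₗ[ℂ] Matrix n n ℂ := LinearMap.id - γ ∘ₗ α
  have hf : ∀ W, f W = W - γ (α W) := fun W => rfl
  have hann : ∀ s, ∀ Y ∈ h.fixedAlgebra, ∀ Y' ∈ h.fixedAlgebra, ∀ W,
      (E s * (Y * f W * Y')).trace = 0 := by
    intro s Y hY Y' hY' W
    have h1 : γ (α (Y * W * Y')) = Y * γ (α W) * Y' := by
      rw [h.map_mul hY', h.map_mul' hY, h.symm.map_mul (congrArg α hY'),
        h.symm.map_mul' (congrArg α hY), show γ (α Y) = Y from hY,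
        show γ (α Y') = Y' from hY']
    rw [hf, Matrix.mul_sub, Matrix.sub_mul, ← h1, Matrix.mul_sub, Matrix.trace_sub,
      h.trace_right, h.trace_left, sub_self]
  have hdisj : Disjoint (LinearMap.ker f) (LinearMap.range f) := by
    rw [Submodule.disjoint_def]
    rintro X hX ⟨W, rfl⟩
    have hX' : f W ∈ h.fixedAlgebra := by
      rw [LinearMap.mem_ker, hf, sub_eq_zero] at hX
      exact hX.symm
    obtain ⟨s⟩ := ‹Nonempty ι›
    refine eq_zero_of_trace_mul_eq_zero (h.right_posDef s) ?_
    rw [← hann s _ (conjTranspose_mem hX') 1 (one_mem _) W, Matrix.mul_one]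
  have htop : LinearMap.ker f ⊔ LinearMap.range f = ⊤ := by
    refine Submodule.eq_top_of_disjoint _ _ ?_ hdisj
    rw [add_comm, LinearMap.finrank_range_add_finrank_ker]
  intro X
  obtain ⟨c, hc, _, ⟨W, rfl⟩, rfl⟩ := Submodule.mem_sup.1 (htop ▸ Submodule.mem_top (x := X))
  have hc' : c ∈ h.fixedAlgebra := by
    rw [LinearMap.mem_ker, hf, sub_eq_zero] at hc
    exact hc.symm
  refine ⟨c, hc', fun s Y hY Y' hY' => ?_⟩
  rw [Matrix.mul_add, Matrix.add_mul, Matrix.mul_add, Matrix.trace_add, hann s Y hY Y' hY' W,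
    add_zero]

/-- Minimal projections are transported along the isomorphism `α` of fixed point algebras. -/
theorem isMinimalProjection_map (h : IsReversiblePair α γ D E) {A : Set (Matrix n n ℂ)}
    {B : Set (Matrix m m ℂ)} (hA : A ⊆ h.fixedAlgebra) (hAB : ∀ X ∈ A, α X ∈ B)
    (hB : B ⊆ h.symm.fixedAlgebra) (hBA : ∀ Y ∈ B, γ Y ∈ A) {e : Matrix n n ℂ}
    (he : IsMinimalProjection A e) : IsMinimalProjection B (α e) := by
  have hγe : γ (α e) = e := hA he.mem
  refine ⟨hAB e he.mem, ⟨?_, ?_⟩, fun h0 => he.ne_zero ?_, fun f hf hfp hef => ?_⟩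
  · rw [IsIdempotentElem, ← h.map_mul hγe, he.mul_self]
  · change (α e)ᴴ = α e
    rw [← h.left_pos.map_conjTranspose, he.conjTranspose]
  · rw [← hγe, h0, map_zero]
  · have hγf : α (γ f) = f := hB hf
    have h1 : IsStarProjection (γ f) := by
      constructor
      · rw [IsIdempotentElem, ← h.symm.map_mul hγf, hfp.isIdempotentElem]
      · change (γ f)ᴴ = γ f
        rw [← h.right_pos.map_conjTranspose, show fᴴ = f from hfp.isSelfAdjoint]
    have h2 : e * γ f = γ f := by
      nth_rewrite 1 [← hγe]
      rw [← h.symm.map_mul hγf, hef]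
    rcases he.minimal _ (hBA f hf) h1 h2 with h3 | h3
    · left
      rw [← hγf, h3, map_zero]
    · right
      rw [← hγf, h3]

theorem isMinimalProjection_fixedAlgebra (h : IsReversiblePair α γ D E) {e : Matrix n n ℂ}
    (he : IsMinimalProjection (h.fixedAlgebra : Set (Matrix n n ℂ)) e) :
    IsMinimalProjection (h.symm.fixedAlgebra : Set (Matrix m m ℂ)) (α e) :=
  h.isMinimalProjection_map subset_rfl (fun _ hX => h.map_mem hX) subset_rfl
    (fun _ hY => h.symm.map_mem hY) he

theorem map_mem_center (h : IsReversiblePair α γ D E) {X : Matrix n n ℂ}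
    (hX : X ∈ (h.fixedAlgebra : Set (Matrix n n ℂ)) ∩ Set.centralizer h.fixedAlgebra) :
    α X ∈ (h.symm.fixedAlgebra : Set (Matrix m m ℂ)) ∩ Set.centralizer h.symm.fixedAlgebra := by
  refine ⟨h.map_mem hX.1, fun Y hY => ?_⟩
  have hY' : α (γ Y) = Y := hY
  have h1 := hX.2 (γ Y) (h.symm.map_mem hY)
  rw [← hY', ← h.map_mul hX.1, h1, h.map_mul' hX.1]

theorem isMinimalCentral_map (h : IsReversiblePair α γ D E) {z : Matrix n n ℂ}
    (hz : IsMinimalCentral h.fixedAlgebra z) : IsMinimalCentral h.symm.fixedAlgebra (α z) :=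
  h.isMinimalProjection_map Set.inter_subset_left (fun _ hX => h.map_mem_center hX)
    Set.inter_subset_left (fun _ hY => h.symm.map_mem_center hY) hz

/-- The isomorphism `α` multiplies the trace of a factor of the fixed point algebra by
a constant. -/
theorem exists_trace_map_eq (h : IsReversiblePair α γ D E) {z : Matrix n n ℂ}
    (hz : IsMinimalCentral h.fixedAlgebra z) :
    ∃ κ : ℂ, ∀ X ∈ h.fixedAlgebra, (α (X * z)).trace = κ * (X * z).trace := by
  -- The adjoint of `α` represents the functional `X ↦ tr (α X)`, which is a trace on the fixed
  -- point algebra.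
  have hM : ∀ X, (hsAdjoint α 1 * X).trace = (α X).trace := fun X => by
    rw [Matrix.trace_mul_comm, trace_mul_hsAdjoint h.left_pos, Matrix.mul_one]
  obtain ⟨κ, hκ⟩ := hz.exists_trace_eq_smul (M := hsAdjoint α 1) (fun X hX Y hY => by
    rw [hM, hM, h.map_mul hY, h.map_mul hX, Matrix.trace_mul_comm])
  exact ⟨κ, fun X hX => by rw [← hM, hκ X hX]⟩

/-- Restrictions of functionals to a factor of the fixed point algebra have corresponding
densities. -/
theorem map_density_eq (h : IsReversiblePair α γ D E) {z S : Matrix n n ℂ} {S' : Matrix m m ℂ}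
    (hz : IsMinimalCentral h.fixedAlgebra z) (s : ι)
    (hS : S ∈ corner z (h.fixedAlgebra : Set (Matrix n n ℂ)))
    (hSE : ∀ e, IsMinimalProjection (h.fixedAlgebra : Set (Matrix n n ℂ)) e → z * e = e →
      ∀ X ∈ h.fixedAlgebra,
        (E s * z).trace * (S * X).trace = e.trace * (E s * (X * z)).trace)
    (hS' : S' ∈ h.symm.fixedAlgebra)
    (hSD : ∀ e, IsMinimalProjection (h.symm.fixedAlgebra : Set (Matrix m m ℂ)) e →
      α z * e = e → ∀ Y ∈ h.symm.fixedAlgebra,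
        (D s * α z).trace * (S' * Y).trace = e.trace * (D s * (Y * α z)).trace) :
    α S = S' := by
  obtain ⟨S₁, hS₁, hS₂⟩ := hS
  have hzS : z * S = S := by
    rw [← hS₂]
    simp only
    rw [← Matrix.mul_assoc, hz.mul_self]
  have hSN : S ∈ h.fixedAlgebra := hS₂ ▸ mul_mem hz.mem_left hS₁
  obtain ⟨κ, hκ⟩ := h.exists_trace_map_eq hz
  obtain ⟨e, he, hze⟩ := exists_isMinimalProjection_le
    (N := (h.fixedAlgebra : Set (Matrix n n ℂ))) hz.mem_left hz.isStarProjection hz.ne_zero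
  have heN : e ∈ h.fixedAlgebra := he.mem
  refine eq_of_mem_of_trace_eq (h.map_mem hSN) hS' fun Y hY => ?_
  obtain ⟨X, hX, rfl⟩ : ∃ X ∈ h.fixedAlgebra, α X = Y := ⟨γ Y, h.symm.map_mem hY, hY⟩
  -- Both sides represent the same functional on `Y`, with `κ` the ratio of the traces of `α e`
  -- and `e`.
  have hpos := trace_mul_pos h.right_posDef hz s
  have h1 : (E s * z).trace * (S' * α X).trace = (α e).trace * (E s * (X * z)).trace := by
    have h2 := hSD (α e) (h.isMinimalProjection_fixedAlgebra he)
      (by rw [← h.map_mul heN, hze]) (α X) (h.map_mem hX)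
    rwa [h.trace_left, ← h.map_mul hz.mem_left, h.trace_left] at h2
  have h3 : (α e).trace = κ * e.trace := by
    have h4 := hκ e heN
    rwa [← hz.comm heN, hze] at h4
  have h5 : (α S * α X).trace = κ * (S * X).trace := by
    have h6 := hκ (S * X) (mul_mem hSN hX)
    rwa [← hz.comm (mul_mem hSN hX), ← Matrix.mul_assoc, hzS, h.map_mul hX] at h6
  refine mul_left_cancel₀ hpos.ne' ?_
  rw [h1, h5, h3, mul_left_comm, hSE e he hze X hX]
  ring

end IsReversiblePair

end Reversible

/-! ### The decomposition for sufficient maps -/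

section Sufficient

variable {m n : Type*} [Fintype m] [Fintype n] [DecidableEq m] [DecidableEq n] {ι : Type*}
  [Nonempty ι]

/-- The subalgebra of the decomposition is the fixed point algebra of `γ ∘ α`, where `α` and `γ`
are the adjoints of `T` and of a recovery map. -/
theorem IsSufficient.exists_isDecomposition {T : Matrix m m ℂ →ₗ[ℂ] Matrix n n ℂ}
    (hT : IsTwoPositive T) (hTr : IsTracePreserving T) {D : ι → Matrix m m ℂ}
    (hD : ∀ s, (D s).PosDef) (hD1 : ∀ s, (D s).trace = 1) (hTD : ∀ s, (T (D s)).PosDef)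
    (hsuff : IsSufficient T D) :
    ∃ (A : StarSubalgebra ℂ (Matrix n n ℂ)) (r : ℕ) (z : Fin r → Matrix n n ℂ)
      (w : ι → Fin r → ℝ) (S : ι → Fin r → Matrix n n ℂ)
      (R : Fin r → Matrix n n ℂ) (Q : Fin r → Matrix m m ℂ),
      IsDecomposition T D A z w S R Q := by
  obtain ⟨β, hβ, hβTr, hβD⟩ := hsuff
  have h : IsReversiblePair (hsAdjoint T) (hsAdjoint β) D (fun s => T (D s)) :=
    { left_pos := hT.hsAdjoint
      right_pos := hβ.hsAdjoint
      left_one := hsAdjoint_one hT hTr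
      right_one := hsAdjoint_one hβ hβTr
      left_posDef := hD
      right_posDef := hTD
      trace_left := fun s X => trace_mul_hsAdjoint hT _ _
      trace_right := fun s Y => by rw [trace_mul_hsAdjoint hβ, hβD] }
  obtain ⟨r, z, hz⟩ := exists_isMinimalCentralFamily h.fixedAlgebra
  have hzp := hz.isMinimalCentral
  have hzp' := fun p => h.isMinimalCentral_map (hzp p)
  choose S R hS hR hSR hSX using fun p =>
    h.admitsExpectation.exists_isDensityIn h.right_posDef (hzp p)
  choose S' Q hS' hQ hSQ hSX' using fun p =>
    h.symm.admitsExpectation.exists_isDensityIn h.left_posDef (hzp' p)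
  have hmap : ∀ s p, hsAdjoint T (S p s) = S' p s := fun s p => by
    refine h.map_density_eq (hzp p) s (hS p s).mem (hSX p s) ?_ (hSX' p s)
    obtain ⟨U, hU, hUS⟩ := (hS' p s).mem
    exact hUS ▸ mul_mem (hzp' p).mem_left hU
  have hpos := fun s p => trace_mul_pos h.right_posDef (hzp p) s
  -- The weights, as complex numbers, are the values of the functionals at the central projections.
  have hre : ∀ s p, (((T (D s) * z p).trace.re : ℝ) : ℂ) = (T (D s) * z p).trace := fun s p =>
    Complex.ext rfl (by simpa using (Complex.pos_iff.1 (hpos s p)).2)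
  refine ⟨h.fixedAlgebra, r, z, fun s p => (T (D s) * z p).trace.re, fun s p => S p s, R, Q,
    { central := hz
      prob := fun s => ⟨fun p => (Complex.pos_iff.1 (hpos s p)).1.le, ?_⟩
      map_mul := fun X Y hY => h.map_mul hY X
      density_left := fun s p => hS p s
      density_right := fun p => by rw [← coe_commutant]; exact hR p
      image_eq := fun s => ?_
      density_source := fun p => by
        rw [h.image_fixedAlgebra, ← coe_commutant]
        exact hQ p
      source_eq := fun s => ?_ }⟩
  · have h1 : ∑ p, (T (D s) * z p).trace = 1 := by
      rw [← Matrix.trace_sum, ← Finset.mul_sum, hz.sum_eq_one, Matrix.mul_one, hTr, hD1]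
    rw [← Complex.re_sum, h1, Complex.one_re]
  · simp only [hre]
    simp only [← hSR]
    rw [← Finset.mul_sum, hz.sum_eq_one, Matrix.mul_one]
  · simp only [hre, hmap]
    simp only [← h.trace_left, ← hSQ]
    rw [← Finset.mul_sum, ← map_sum, hz.sum_eq_one, h.left_one, Matrix.mul_one]

end Sufficient

/-! ### Imaginary powers -/

section FunctionalCalculus

variable {m n : Type*} [Fintype m] [Fintype n] [DecidableEq m] [DecidableEq n]

open scoped MatrixOrder in
theorem spectrum_pos_of_posDef {a : Matrix n n ℂ} (ha : a.PosDef) {x : ℝ}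
    (hx : x ∈ spectrum ℝ a) : 0 < x :=
  (Matrix.isStrictlyPositive_iff_posDef.2 ha).spectrum_pos hx

/-- Inside a *-algebra, a positive definite element has a Hermitian square root `x`
with a Hermitian inverse. -/
theorem exists_sqrt_of_posDef {N : StarSubalgebra ℂ (Matrix n n ℂ)} {a : Matrix n n ℂ}
    (ha : a.PosDef) (haN : a ∈ N) :
    ∃ x ∈ N, ∃ x' ∈ N, xᴴ = x ∧ x'ᴴ = x' ∧ x * x = a ∧ x' * x = 1 ∧ x * x' = 1 := by
  have hsa : IsSelfAdjoint a := ha.isHermitian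
  have hc : ∀ f : ℝ → ℝ, ContinuousOn f (spectrum ℝ a) := fun f => continuousOn_spectrum f a
  have hs : ∀ x ∈ spectrum ℝ a, √x ≠ 0 := fun x hx =>
    (Real.sqrt_pos.2 (spectrum_pos_of_posDef ha hx)).ne'
  refine ⟨cfc Real.sqrt a, cfc_mem N haN _, cfc (fun x => (√x)⁻¹) a, cfc_mem N haN _,
    cfc_predicate (p := IsSelfAdjoint) _ a, cfc_predicate (p := IsSelfAdjoint) _ a, ?_, ?_, ?_⟩
  · rw [← cfc_mul _ _ a (hc _) (hc _)]
    refine (cfc_congr fun x hx => ?_).trans (cfc_id' ℝ a hsa)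
    exact Real.mul_self_sqrt (spectrum_pos_of_posDef ha hx).le
  · rw [← cfc_mul _ _ a (hc _) (hc _), ← cfc_const_one ℝ a hsa]
    exact cfc_congr fun x hx => inv_mul_cancel₀ (hs x hx)
  · rw [← cfc_mul _ _ a (hc _) (hc _), ← cfc_const_one ℝ a hsa]
    exact cfc_congr fun x hx => mul_inv_cancel₀ (hs x hx)

section Norm

open scoped MatrixOrder Matrix.Norms.L2Operator

theorem exp_cfc_log {a : Matrix n n ℂ} (ha : a.PosDef) :
    NormedSpace.exp (cfc Real.log a) = a :=
  CFC.exp_log a (Matrix.isStrictlyPositive_iff_posDef.2 ha)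

theorem cfc_log_exp {a : Matrix n n ℂ} (ha : a.IsHermitian) :
    cfc Real.log (NormedSpace.exp a) = a :=
  CFC.log_exp a ha

theorem hasSum_exp (a : Matrix n n ℂ) :
    HasSum (fun k : ℕ => ((k.factorial : ℂ)⁻¹) • a ^ k) (NormedSpace.exp a) :=
  NormedSpace.exp_series_hasSum_exp' (𝕂 := ℂ) a

end Norm

/-- Both sides have the same exponential, and `log` inverts `exp` on Hermitian matrices. -/
theorem cfc_log_mul {a b : Matrix n n ℂ} (ha : a.PosDef) (hb : b.PosDef) (hab : Commute a b) :
    cfc Real.log (a * b) = cfc Real.log a + cfc Real.log b := by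
  have hsa : IsSelfAdjoint a := ha.isHermitian
  have hsb : IsSelfAdjoint b := hb.isHermitian
  have hla : (cfc Real.log a).IsHermitian := cfc_predicate (p := IsSelfAdjoint) _ a
  have hlb : (cfc Real.log b).IsHermitian := cfc_predicate (p := IsSelfAdjoint) _ b
  have hc : Commute (cfc Real.log a) (cfc Real.log b) :=
    (hsb.commute_cfc (hsa.commute_cfc hab Real.log).symm Real.log).symm
  rw [← cfc_log_exp (hla.add hlb), Matrix.exp_add_of_commute _ _ hc, exp_cfc_log ha,
    exp_cfc_log hb]

theorem imagPow_mul {a b : Matrix n n ℂ} (ha : a.PosDef) (hb : b.PosDef) (hab : Commute a b)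
    (t : ℝ) : imagPow (a * b) t = imagPow a t * imagPow b t := by
  have hsa : IsSelfAdjoint a := ha.isHermitian
  have hsb : IsSelfAdjoint b := hb.isHermitian
  have hc : Commute (cfc Real.log a) (cfc Real.log b) :=
    (hsb.commute_cfc (hsa.commute_cfc hab Real.log).symm Real.log).symm
  rw [imagPow, cfc_log_mul ha hb hab, smul_add,
    Matrix.exp_add_of_commute _ _ ((hc.smul_left _).smul_right _), imagPow, imagPow]

theorem imagPow_mul_imagPow_neg (a : Matrix n n ℂ) (t : ℝ) :
    imagPow a t * imagPow a (-t) = 1 := by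
  rw [imagPow, imagPow, ← Matrix.exp_add_of_commute _ _
    (((Commute.refl (cfc Real.log a)).smul_left _).smul_right _), ← add_smul]
  simp

theorem exp_mem {N : StarSubalgebra ℂ (Matrix n n ℂ)} {a : Matrix n n ℂ} (ha : a ∈ N) :
    NormedSpace.exp a ∈ N := by
  -- A finite-dimensional algebra is closed, so it contains the sum of the exponential series.
  have hcl : IsClosed (N.toSubalgebra.toSubmodule : Set (Matrix n n ℂ)) :=
    Submodule.closed_of_finiteDimensional _
  exact hcl.mem_of_tendsto (hasSum_exp a) (Filter.Eventually.of_forall fun s =>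
    Submodule.sum_mem N.toSubalgebra.toSubmodule fun k _ =>
      N.smul_mem (pow_mem (M := Matrix n n ℂ) ha k) _)

theorem imagPow_mem {N : StarSubalgebra ℂ (Matrix n n ℂ)} {a : Matrix n n ℂ} (ha : a ∈ N)
    (t : ℝ) : imagPow a t ∈ N :=
  exp_mem (N.smul_mem (cfc_mem N ha _) _)

section MultiplicativeMap

variable {α : Matrix n n ℂ →ₗ[ℂ] Matrix m m ℂ} {N : StarSubalgebra ℂ (Matrix n n ℂ)}

theorem map_pow_of_map_mul (h1 : α 1 = 1) (hα : ∀ X, ∀ Y ∈ N, α (X * Y) = α X * α Y)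
    {a : Matrix n n ℂ} (ha : a ∈ N) (k : ℕ) : α (a ^ k) = α a ^ k := by
  induction k with
  | zero => simp [h1]
  | succ k ih => rw [pow_succ, pow_succ, hα _ _ ha, ih]

theorem map_cfc_of_map_mul (h1 : α 1 = 1) (hα : ∀ X, ∀ Y ∈ N, α (X * Y) = α X * α Y)
    {a : Matrix n n ℂ} (ha : a ∈ N) (hsa : IsSelfAdjoint a) (hsα : IsSelfAdjoint (α a))
    (f : ℝ → ℝ) : α (cfc f a) = cfc f (α a) := by
  -- One polynomial interpolates `f` on both spectra.
  obtain ⟨p, hp⟩ := exists_polynomial_eqOn f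
    ((Matrix.finite_real_spectrum (A := a)).union (Matrix.finite_real_spectrum (A := α a)))
  rw [cfc_congr (hp.mono Set.subset_union_left), cfc_congr (hp.mono Set.subset_union_right),
    cfc_polynomial p a hsa, cfc_polynomial p (α a) hsα, Polynomial.aeval_eq_sum_range,
    Polynomial.aeval_eq_sum_range, map_sum]
  refine Finset.sum_congr rfl fun k _ => ?_
  rw [LinearMap.map_smul_of_tower, map_pow_of_map_mul h1 hα ha]

theorem map_exp_of_map_mul (h1 : α 1 = 1) (hα : ∀ X, ∀ Y ∈ N, α (X * Y) = α X * α Y)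
    {a : Matrix n n ℂ} (ha : a ∈ N) : α (NormedSpace.exp a) = NormedSpace.exp (α a) := by
  have h2 := (hasSum_exp a).map α (LinearMap.continuous_of_finiteDimensional α)
  refine h2.unique ?_
  convert hasSum_exp (α a) using 2 with k
  simp [map_pow_of_map_mul h1 hα ha]

theorem map_imagPow_of_map_mul (h1 : α 1 = 1) (hα : ∀ X, ∀ Y ∈ N, α (X * Y) = α X * α Y)
    {a : Matrix n n ℂ} (ha : a ∈ N) (hsa : IsSelfAdjoint a) (hsα : IsSelfAdjoint (α a))
    (t : ℝ) : α (imagPow a t) = imagPow (α a) t := by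
  rw [imagPow, map_exp_of_map_mul h1 hα (N.smul_mem (cfc_mem N ha _) _), map_smul,
    map_cfc_of_map_mul h1 hα ha hsa hsα, imagPow]

end MultiplicativeMap

end FunctionalCalculus

/-! ### Recovery from a decomposition -/

section Recovery

variable {m n : Type*} [Fintype m] [Fintype n] [DecidableEq m] [DecidableEq n]

/-- The map `X ↦ M X Mᴴ`. -/
def conjMap (M : Matrix n n ℂ) : Matrix n n ℂ →ₗ[ℂ] Matrix n n ℂ :=
  LinearMap.mulLeft ℂ M ∘ₗ LinearMap.mulRight ℂ Mᴴ

theorem conjMap_apply (M X : Matrix n n ℂ) : conjMap M X = M * (X * Mᴴ) := rfl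

theorem isTwoPositive_conjMap (M : Matrix n n ℂ) : IsTwoPositive (conjMap M) := by
  intro A B C D h
  have h1 := h.mul_mul_conjTranspose_same (Matrix.fromBlocks M 0 0 M)
  rw [Matrix.fromBlocks_conjTranspose, Matrix.fromBlocks_multiply, Matrix.fromBlocks_multiply] at h1
  simpa [conjMap_apply, Matrix.mul_assoc] using h1

omit [Fintype m] [Fintype n] [DecidableEq n] [DecidableEq m] in
theorem IsTwoPositive.comp {l : Type*} {S : Matrix n n ℂ →ₗ[ℂ] Matrix l l ℂ}
    {T : Matrix m m ℂ →ₗ[ℂ] Matrix n n ℂ} (hS : IsTwoPositive S) (hT : IsTwoPositive T) :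
    IsTwoPositive (S ∘ₗ T) := fun A B C D h => hS _ _ _ _ (hT A B C D h)

/-- The factorization `T (D s) = σ s ρ`, `D s = T* (σ s) q` of the densities, with `σ s` in
a *-algebra `N` on which `T*` is multiplicative and with the index-independent factors `ρ` in the
commutant of `N` and `q` in the commutant of `T* (N)`. -/
structure IsFactorization {ι : Type*} (T : Matrix m m ℂ →ₗ[ℂ] Matrix n n ℂ)
    (D : ι → Matrix m m ℂ) (N : StarSubalgebra ℂ (Matrix n n ℂ)) (σ : ι → Matrix n n ℂ)
    (ρ : Matrix n n ℂ) (q : Matrix m m ℂ) : Prop where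
  map_mul : ∀ X, ∀ Y ∈ N, hsAdjoint T (X * Y) = hsAdjoint T X * hsAdjoint T Y
  mem : ∀ s, σ s ∈ N
  mem_commutant : ρ ∈ commutant N
  comm : ∀ X ∈ N, hsAdjoint T X * q = q * hsAdjoint T X
  posDef : ∀ s, (σ s).PosDef
  posDef_map : ∀ s, (hsAdjoint T (σ s)).PosDef
  posDef_right : ρ.PosDef
  posDef_source : q.PosDef
  image_eq : ∀ s, T (D s) = σ s * ρ
  source_eq : ∀ s, D s = hsAdjoint T (σ s) * q

variable {ι : Type*} {T : Matrix m m ℂ →ₗ[ℂ] Matrix n n ℂ} {D : ι → Matrix m m ℂ}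

theorem posDef_of_isUnit_mul_left {a b : Matrix n n ℂ} (h : IsUnit (a * b))
    (ha : a.PosSemidef) : a.PosDef := by
  refine ha.posDef_iff_isUnit.2 ?_
  rw [Matrix.isUnit_iff_isUnit_det, Matrix.det_mul] at *
  exact isUnit_of_mul_isUnit_left h

theorem posDef_of_isUnit_mul_right {a b : Matrix n n ℂ} (h : IsUnit (a * b))
    (hb : b.PosSemidef) : b.PosDef := by
  refine hb.posDef_iff_isUnit.2 ?_
  rw [Matrix.isUnit_iff_isUnit_det, Matrix.det_mul] at *
  exact isUnit_of_mul_isUnit_right h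

/-- Summing over the orthogonal minimal central projections turns the blockwise decomposition
into a factorization. -/
theorem IsDecomposition.exists_isFactorization (hT : IsTwoPositive T) (hD : ∀ s, IsUnit (D s))
    (hTD : ∀ s, IsUnit (T (D s))) [Nonempty ι]
    {A : StarSubalgebra ℂ (Matrix n n ℂ)} {r : ℕ} {z : Fin r → Matrix n n ℂ}
    {w : ι → Fin r → ℝ} {S : ι → Fin r → Matrix n n ℂ} {R : Fin r → Matrix n n ℂ}
    {Q : Fin r → Matrix m m ℂ} (h : IsDecomposition T D A z w S R Q) :
    ∃ (σ : ι → Matrix n n ℂ) (ρ : Matrix n n ℂ) (q : Matrix m m ℂ),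
      IsFactorization T D A σ ρ q := by
  obtain ⟨s₀⟩ := id ‹Nonempty ι›
  have hzp := h.central.isMinimalCentral
  choose S' hS' hSS using fun s p => (h.density_left s p).mem
  choose R' hR' hRR using fun p => (h.density_right p).mem
  choose Q' hQ' hQQ using fun p => (h.density_source p).mem
  simp only at hSS hRR hQQ
  have hSA : ∀ s p, S s p ∈ A := fun s p => hSS s p ▸ mul_mem (hzp p).mem_left (hS' s p)
  have hRA : ∀ p, R p ∈ commutant A := fun p => hRR p ▸ mul_mem (hzp p).mem_commutant
    (by rw [← SetLike.mem_coe, coe_commutant]; exact hR' p)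
  have hSz : ∀ s p, S s p = S' s p * z p := fun s p => by
    rw [← hSS, (hzp p).comm (hS' s p)]
  have hSR : ∀ s p p', p ≠ p' → S s p * R p' = 0 := fun s p p' hp => by
    rw [hSz, ← hRR, Matrix.mul_assoc, ← Matrix.mul_assoc (z p), h.central.mul_eq_zero hp,
      Matrix.zero_mul, Matrix.mul_zero]
  have hSQ : ∀ s p p', p ≠ p' → hsAdjoint T (S s p) * Q p' = 0 := fun s p p' hp => by
    rw [hSz, h.map_mul _ _ (hzp p).mem_left, ← hQQ, Matrix.mul_assoc,
      ← Matrix.mul_assoc (hsAdjoint T (z p)), ← h.map_mul _ _ (hzp p').mem_left,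
      h.central.mul_eq_zero hp, map_zero, Matrix.zero_mul, Matrix.mul_zero]
  have hσA : ∀ s, ∑ p, (w s p : ℂ) • S s p ∈ A := fun s =>
    sum_mem fun p _ => A.smul_mem (hSA s p) _
  have hσpos : ∀ s, (∑ p, (w s p : ℂ) • S s p).PosSemidef := fun s =>
    Matrix.posSemidef_sum _ fun p _ => (h.density_left s p).posSemidef.smul
      (Complex.zero_le_real.2 ((h.prob s).1 p))
  have himage : ∀ s, T (D s) = (∑ p, (w s p : ℂ) • S s p) * ∑ p, R p := fun s => by
    rw [h.image_eq s, Finset.sum_mul]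
    refine Finset.sum_congr rfl fun p _ => ?_
    rw [Matrix.smul_mul, Finset.mul_sum, Finset.sum_eq_single p
      (fun p' _ hp => hSR s p p' hp.symm) (by simp)]
  have hsource : ∀ s, D s = hsAdjoint T (∑ p, (w s p : ℂ) • S s p) * ∑ p, Q p := fun s => by
    rw [h.source_eq s, map_sum, Finset.sum_mul]
    refine Finset.sum_congr rfl fun p _ => ?_
    rw [map_smul, Matrix.smul_mul, Finset.mul_sum, Finset.sum_eq_single p
      (fun p' _ hp => hSQ s p p' hp.symm) (by simp)]
  refine ⟨fun s => ∑ p, (w s p : ℂ) • S s p, ∑ p, R p, ∑ p, Q p,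
    { map_mul := h.map_mul
      mem := hσA
      mem_commutant := sum_mem fun p _ => hRA p
      comm := fun X hX => ?_
      posDef := fun s => posDef_of_isUnit_mul_left (himage s ▸ hTD s) (hσpos s)
      posDef_map := fun s => posDef_of_isUnit_mul_left (hsource s ▸ hD s)
        (hT.hsAdjoint.map_posSemidef (hσpos s))
      posDef_right := posDef_of_isUnit_mul_right (himage s₀ ▸ hTD s₀)
        (Matrix.posSemidef_sum _ fun p _ => (h.density_right p).posSemidef)
      posDef_source := posDef_of_isUnit_mul_right (hsource s₀ ▸ hD s₀)
        (Matrix.posSemidef_sum _ fun p _ => (h.density_source p).posSemidef)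
      image_eq := himage
      source_eq := hsource }⟩
  rw [Finset.mul_sum, Finset.sum_mul]
  refine Finset.sum_congr rfl fun p _ => ?_
  have h1 : hsAdjoint T X * Q' p = Q' p * hsAdjoint T X := hQ' p _ ⟨X, hX, rfl⟩
  rw [← hQQ, ← Matrix.mul_assoc, ← h.map_mul _ _ (hzp p).mem_left, ← (hzp p).comm hX,
    h.map_mul _ _ hX, Matrix.mul_assoc, h1, Matrix.mul_assoc]

namespace IsFactorization

variable {N : StarSubalgebra ℂ (Matrix n n ℂ)} {σ : ι → Matrix n n ℂ} {ρ : Matrix n n ℂ}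
  {q : Matrix m m ℂ}

theorem comm_right (h : IsFactorization T D N σ ρ q) (s : ι) : Commute (σ s) ρ :=
  CoarseGraining.mem_commutant.1 h.mem_commutant _ (h.mem s)

theorem comm_source (h : IsFactorization T D N σ ρ q) (s : ι) :
    Commute (hsAdjoint T (σ s)) q := h.comm _ (h.mem s)

/-- The common factors cancel in the cocycles. -/
theorem map_cocycle (h : IsFactorization T D N σ ρ q) (hT : IsTwoPositive T)
    (hTr : IsTracePreserving T) (s s' : ι) (t : ℝ) :
    hsAdjoint T (imagPow (T (D s)) t * imagPow (T (D s')) (-t)) =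
      imagPow (D s) t * imagPow (D s') (-t) := by
  have h1 := hsAdjoint_one hT hTr
  have e1 : imagPow (T (D s)) t * imagPow (T (D s')) (-t) =
      imagPow (σ s) t * imagPow (σ s') (-t) := by
    rw [h.image_eq, h.image_eq, imagPow_mul (h.posDef s) h.posDef_right (h.comm_right s),
      (h.comm_right s').eq, imagPow_mul h.posDef_right (h.posDef s') (h.comm_right s').symm,
      Matrix.mul_assoc, ← Matrix.mul_assoc (imagPow ρ t), imagPow_mul_imagPow_neg, Matrix.one_mul]
  have e2 : imagPow (D s) t * imagPow (D s') (-t) =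
      imagPow (hsAdjoint T (σ s)) t * imagPow (hsAdjoint T (σ s')) (-t) := by
    rw [h.source_eq s, h.source_eq s', imagPow_mul (h.posDef_map s) h.posDef_source
      (h.comm_source s), (h.comm_source s').eq, imagPow_mul h.posDef_source (h.posDef_map s')
      (h.comm_source s').symm, Matrix.mul_assoc, ← Matrix.mul_assoc (imagPow q t),
      imagPow_mul_imagPow_neg, Matrix.one_mul]
  rw [e1, e2, h.map_mul _ _ (imagPow_mem (h.mem s') _),
    map_imagPow_of_map_mul h1 h.map_mul (h.mem s) (h.posDef s).isHermitian
      (h.posDef_map s).isHermitian,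
    map_imagPow_of_map_mul h1 h.map_mul (h.mem s') (h.posDef s').isHermitian
      (h.posDef_map s').isHermitian]

/-- The recovery map is `Y ↦ D^{1/2} T*(T(D)^{-1/2} Y T(D)^{-1/2}) D^{1/2}` for one of the
densities `D`. -/
theorem isSufficient (h : IsFactorization T D N σ ρ q) [Nonempty ι] (hT : IsTwoPositive T)
    (hTr : IsTracePreserving T) : IsSufficient T D := by
  obtain ⟨s₀⟩ := id ‹Nonempty ι›
  have h1 := hsAdjoint_one hT hTr
  obtain ⟨x, hx, x', hx', hxh, hxh', hxx, hx'x, hxx'⟩ :=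
    exists_sqrt_of_posDef (h.posDef s₀) (h.mem s₀)
  obtain ⟨y, hy, y', hy', hyh, hyh', hyy, hy'y, hyy'⟩ :=
    exists_sqrt_of_posDef h.posDef_right h.mem_commutant
  obtain ⟨k, hk, -, -, hkh, -, hkk, -, -⟩ := exists_sqrt_of_posDef
    (N := StarSubalgebra.centralizer ℂ (hsAdjoint T '' N)) h.posDef_source (by
      rw [StarSubalgebra.mem_centralizer_iff]
      rintro _ ⟨X, hX, rfl⟩
      refine ⟨h.comm X hX, ?_⟩
      change (hsAdjoint T X)ᴴ * q = q * (hsAdjoint T X)ᴴ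
      rw [← hsAdjoint_conjTranspose hT]
      exact h.comm _ (conjTranspose_mem hX))
  have hkc : ∀ X ∈ N, hsAdjoint T X * k = k * hsAdjoint T X := fun X hX =>
    ((StarSubalgebra.mem_centralizer_iff ℂ).1 hk _ ⟨X, hX, rfl⟩).1
  have hcomm : ∀ X ∈ N, ∀ Y ∈ commutant N, X * Y = Y * X := fun X hX Y hY =>
    CoarseGraining.mem_commutant.1 hY X hX
  -- Here `x * y` is a square root of `T (D s₀)` with inverse `x' * y'`, and `k * T* x` is a factor
  -- of `D s₀`.
  have hρ : y' * ρ * y' = 1 := by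
    rw [← hyy, ← Matrix.mul_assoc, hy'y, Matrix.one_mul, hyy']
  have hσ : x' * σ s₀ * x' = 1 := by
    rw [← hxx, ← Matrix.mul_assoc, hx'x, Matrix.one_mul, hxx']
  have hvh : (x' * y')ᴴ = x' * y' := by
    rw [Matrix.conjTranspose_mul, hxh', hyh', hcomm x' hx' y' hy']
  have huh : (k * hsAdjoint T x)ᴴ = hsAdjoint T x * k := by
    rw [Matrix.conjTranspose_mul, hkh, ← hsAdjoint_conjTranspose hT, hxh]
  have hv : ∀ s, x' * y' * (T (D s) * (x' * y')) = x' * σ s * x' := fun s => by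
    rw [h.image_eq]
    calc x' * y' * (σ s * ρ * (x' * y')) = x' * (y' * σ s) * (ρ * x') * y' := by simp only [Matrix.mul_assoc]
      _ = x' * σ s * (y' * x') * ρ * y' := by
        rw [← hcomm _ (h.mem s) y' hy', ← hcomm x' hx' ρ h.mem_commutant]; simp only [Matrix.mul_assoc]
      _ = x' * σ s * x' * (y' * ρ * y') := by rw [← hcomm x' hx' y' hy']; simp only [Matrix.mul_assoc]
      _ = _ := by rw [hρ, Matrix.mul_one]
  refine ⟨conjMap (k * hsAdjoint T x) ∘ₗ hsAdjoint T ∘ₗ conjMap (x' * y'),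
    (isTwoPositive_conjMap _).comp (hT.hsAdjoint.comp (isTwoPositive_conjMap _)),
    fun Y => ?_, fun s => ?_⟩
  · simp only [LinearMap.comp_apply, conjMap_apply, hvh, huh]
    have hD : hsAdjoint T x * k * (k * hsAdjoint T x) = D s₀ := by
      rw [h.source_eq, ← hxx, h.map_mul _ _ hx, ← hkk]
      calc hsAdjoint T x * k * (k * hsAdjoint T x)
          = hsAdjoint T x * (k * (k * hsAdjoint T x)) := by simp only [Matrix.mul_assoc]
        _ = hsAdjoint T x * (k * (hsAdjoint T x * k)) := by rw [← hkc x hx]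
        _ = hsAdjoint T x * ((hsAdjoint T x * k) * k) := by rw [← Matrix.mul_assoc k, ← hkc x hx]
        _ = _ := by simp only [Matrix.mul_assoc]
    rw [Matrix.trace_mul_comm, Matrix.mul_assoc, hD, Matrix.trace_mul_comm,
      trace_mul_hsAdjoint hT, ← Matrix.mul_assoc, ← Matrix.mul_assoc, Matrix.trace_mul_comm,
      ← Matrix.mul_assoc, ← Matrix.mul_assoc, Matrix.mul_assoc (x' * y'), hv, hσ, Matrix.one_mul]
  · simp only [LinearMap.comp_apply, conjMap_apply, hvh, huh, hv]
    have hxα : hsAdjoint T x * hsAdjoint T x' = 1 := by rw [← h.map_mul _ _ hx', hxx', h1]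
    have hxα' : hsAdjoint T x' * hsAdjoint T x = 1 := by rw [← h.map_mul _ _ hx, hx'x, h1]
    rw [h.map_mul _ _ hx', h.map_mul _ _ (h.mem s)]
    calc k * hsAdjoint T x * (hsAdjoint T x' * hsAdjoint T (σ s) * hsAdjoint T x' *
          (hsAdjoint T x * k))
        = k * (hsAdjoint T x * hsAdjoint T x') * hsAdjoint T (σ s) *
          (hsAdjoint T x' * hsAdjoint T x) * k := by simp only [Matrix.mul_assoc]
      _ = k * hsAdjoint T (σ s) * k := by rw [hxα, hxα', Matrix.mul_one, Matrix.mul_one]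
      _ = D s := by rw [← hkc _ (h.mem s), Matrix.mul_assoc, hkk, ← h.source_eq]

end IsFactorization

end Recovery

end CoarseGraining

open CoarseGraining in
theorem mainTheorem1 {m n : Type*} [Fintype m] [Fintype n] [DecidableEq m] [DecidableEq n]
    (T : Matrix m m ℂ →ₗ[ℂ] Matrix n n ℂ) (hT : IsTwoPositive T) (hTr : IsTracePreserving T)
    (D : Fin 2 → Matrix m m ℂ) (hD : ∀ s, IsDensity (D s)) (hDu : ∀ s, IsUnit (D s))
    (hTDu : ∀ s, IsUnit (T (D s))) :
    (IsSufficient T D →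
      ∃ (A : StarSubalgebra ℂ (Matrix n n ℂ)) (r : ℕ) (z : Fin r → Matrix n n ℂ)
        (w : Fin 2 → Fin r → ℝ) (S : Fin 2 → Fin r → Matrix n n ℂ)
        (R : Fin r → Matrix n n ℂ) (Q : Fin r → Matrix m m ℂ),
        IsDecomposition T D A z w S R Q) ∧
    (∀ (A : StarSubalgebra ℂ (Matrix n n ℂ)) (r : ℕ) (z : Fin r → Matrix n n ℂ)
        (w : Fin 2 → Fin r → ℝ) (S : Fin 2 → Fin r → Matrix n n ℂ)
        (R : Fin r → Matrix n n ℂ) (Q : Fin r → Matrix m m ℂ),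
      IsDecomposition T D A z w S R Q →
        (∀ t : ℝ, hsAdjoint T (imagPow (T (D 1)) t * imagPow (T (D 0)) (-t)) =
          imagPow (D 1) t * imagPow (D 0) (-t)) ∧
        IsSufficient T D) := by
  refine ⟨fun h => h.exists_isDecomposition hT hTr
    (fun s => (hD s).1.posDef_iff_isUnit.2 (hDu s)) (fun s => (hD s).2)
    (fun s => (hT.map_posSemidef (hD s).1).posDef_iff_isUnit.2 (hTDu s)),
    fun A r z w S R Q h => ?_⟩
  obtain ⟨σ, ρ, q, hf⟩ := h.exists_isFactorization hT hDu hTDu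
  exact ⟨fun t => hf.map_cocycle hT hTr 1 0 t, hf.isSufficient hT hTr⟩
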